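/- Let $\mathbb K=\mathbb R$ or $\mathbb C$, let $N\ge 2$, and let $I,J\subseteq\mathbb K$ be open connected sets (open intervals if $\mathbb K=\mathbb R$), with variables $x\in I$, $t\in J$. "Smooth" means $C^\infty$ over $\mathbb K$. For $a\in\mathbb K$ and $b\in\mathbb K\cup\{\infty\}$, a *solution of the Ferapontov–Shabat–Yamilov lattice with boundary condition $v_0=a$, $v_N=b$* is a tuple of smooth functions $v_1,\dots,v_{N-1}:I\times J\to\mathbb K$ such that $v_{n-1}\ne v_n$ everywhere for $1\le n\le N$, and $$\partial_t\partial_x v_n=\partial_t v_n\,\partial_x v_n\left(\frac1{v_n-v_{n-1}}-\frac1{v_{n+1}-v_n}\right),\qquad 1\le n\le N-1,$$ where $\frac1{v_N-v_{N-1}}$ is read as $0$ if $v_N=\infty$. It is *nondegenerate* if $\partial_t v_n$ and $\partial_x v_n$ vanish nowhere for $1\le n\le N-2$. For smooth functions $X_1,\dots,X_{N-1}$ on $I$ and $T_1,\dots,T_{N-1}$ on $J$ put $$A_n=\det\Big(\sum_{s=1}^{N-1}X_s^{(i)}T_s^{(j)}\Big)_{i,j=1}^{n-1},\qquad B_n=\det\Big(\sum_{s=1}^{N-1}X_s^{(k-1)}T_s^{(l-1)}\Big)_{k,l=1}^{n}\qquad(A_1=1).$$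 1. (Boundary condition $v_0=0$, $v_N=\infty$.) If $B_1,\dots,B_{N-1}$ vanish nowhere and the functions $v_n=A_n/B_n$ satisfy $v_{n-1}\neq v_n$ everywhere for $1\le n\le N-1$ (with $v_0=0$), then $v_1,\dots,v_{N-1}$ is a nondegenerate solution with $v_0=0$, $v_N=\infty$; moreover $B_N\equiv 0$, and $A_N\ne0$ at every point where $\partial_tv_{N-1}\,\partial_xv_{N-1}\ne0$. Conversely, every nondegenerate solution with $v_0=0$, $v_N=\infty$ is of the form $v_n=A_n/B_n$ on $I\times J$, with $B_1,\dots,B_{N-1}$ nowhere zero, for some smooth $X_s$, $T_s$ ($2N-2$ functions). 2. (Boundary condition $\varphi_0=a$, $\varphi_N=b$ with $a,b\in\mathbb K$, $a\neq b$.) Put $$\varphi_n=\frac{(a-b)A_n}{(a-b)B_n-A_n}+a ,$$ which is the image of $v_n=A_n/B_n$ under the Möbius map $v\mapsto\frac{(a-b)v}{a-b-v}+a$ wherever $B_n\neq0$. If $(a-b)B_n-A_n$ vanishes nowhere for $1\le n\le N-1$ and $\varphi_{n-1}\ne\varphi_n$ everywhere for $1\le n\le N$ (with $\varphi_0=a$,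 $\varphi_N=b$), then $\varphi_1,\dots,\varphi_{N-1}$ is a nondegenerate solution with $\varphi_0=a$, $\varphi_N=b$. Conversely, every nondegenerate solution with $\varphi_0=a$, $\varphi_N=b$ is of this form, with $(a-b)B_n-A_n$ nowhere zero for $1\le n\le N-1$, for some smooth $X_s$, $T_s$. -/

import Mathlib

open scoped ContDiff

namespace FSY

variable {𝕜 : Type*} [RCLike 𝕜]

/-- The partial derivative in the first variable `x`. -/
noncomputable def dx (f : 𝕜 → 𝕜 → 𝕜) (x t : 𝕜) : 𝕜 := deriv (fun y => f y t) x

/-- The partial derivative in the second variable `t`. -/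
noncomputable def dt (f : 𝕜 → 𝕜 → 𝕜) (x t : 𝕜) : 𝕜 := deriv (fun s => f x s) t

/-- The reciprocal difference `1 / (p - q)` on the projective line, with `1 / (p - q) = 0` if one of
`p`, `q` is the point at infinity. It is only used for `p ≠ q`. -/
noncomputable def recipDiff : OnePoint 𝕜 → OnePoint 𝕜 → 𝕜
  | some p, some q => 1 / (p - q)
  | _, _ => 0

/-- The value at site `n` of the finite lattice `v_0 = a, v_1, …, v_{N-1}, v_N = b`; the boundary
value `b` may be the point at infinity. -/
noncomputable def site (N : ℕ) (a : 𝕜) (b : OnePoint 𝕜) (v : ℕ → 𝕜 → 𝕜 → 𝕜) (n : ℕ) (x t : 𝕜) :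
    OnePoint 𝕜 :=
  if n = 0 then (a : OnePoint 𝕜) else if n < N then (v n x t : OnePoint 𝕜) else b

/-- Neighbouring lattice values never coincide on `I × J`, that is, all the differences in the
denominators of the lattice equations are nonzero. -/
def NeighboursDistinct (N : ℕ) (a : 𝕜) (b : OnePoint 𝕜) (I J : Set 𝕜) (v : ℕ → 𝕜 → 𝕜 → 𝕜) : Prop :=
  ∀ n, n < N → ∀ x ∈ I, ∀ t ∈ J, site N a b v n x t ≠ site N a b v (n + 1) x t

/-- `v_1, …, v_{N-1}` is a smooth solution on `I × J` of the Ferapontov-Shabat-Yamilov lattice with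
boundary condition `v_0 = a`, `v_N = b`. -/
structure IsSolution (N : ℕ) (a : 𝕜) (b : OnePoint 𝕜) (I J : Set 𝕜) (v : ℕ → 𝕜 → 𝕜 → 𝕜) : Prop where
  smooth : ∀ n, 1 ≤ n → n < N → ContDiffOn 𝕜 ∞ (fun p : 𝕜 × 𝕜 => v n p.1 p.2) (I ×ˢ J)
  distinct : NeighboursDistinct N a b I J v
  equation : ∀ n, 1 ≤ n → n < N → ∀ x ∈ I, ∀ t ∈ J,
    dx (dt (v n)) x t = dt (v n) x t * dx (v n) x t *
      (recipDiff (site N a b v n x t) (site N a b v (n - 1) x t)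
        - recipDiff (site N a b v (n + 1) x t) (site N a b v n x t))

/-- Nondegeneracy: both first derivatives of `v_1, …, v_{N-2}` are nowhere zero on `I × J`. -/
def Nondegenerate (N : ℕ) (I J : Set 𝕜) (v : ℕ → 𝕜 → 𝕜 → 𝕜) : Prop :=
  ∀ n, 1 ≤ n → n + 1 < N → ∀ x ∈ I, ∀ t ∈ J, dt (v n) x t ≠ 0 ∧ dx (v n) x t ≠ 0

/-- `det (a_ij)`, `1 ≤ i, j ≤ n - 1`, where `a_ij = ∑ s, X_s^(i) T_s^(j)` (for `n ≥ 1`; the empty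
determinant is `1`). -/
noncomputable def detA {m : ℕ} (X T : Fin m → 𝕜 → 𝕜) (n : ℕ) (x t : 𝕜) : 𝕜 :=
  Matrix.det (Matrix.of fun i j : Fin (n - 1) =>
    ∑ s, iteratedDeriv ((i : ℕ) + 1) (X s) x * iteratedDeriv ((j : ℕ) + 1) (T s) t)

/-- `det (b_kl)`, `1 ≤ k, l ≤ n`, where `b_kl = ∑ s, X_s^(k-1) T_s^(l-1)`. -/
noncomputable def detB {m : ℕ} (X T : Fin m → 𝕜 → 𝕜) (n : ℕ) (x t : 𝕜) : 𝕜 :=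
  Matrix.det (Matrix.of fun k l : Fin n =>
    ∑ s, iteratedDeriv (k : ℕ) (X s) x * iteratedDeriv (l : ℕ) (T s) t)

/-- `v_n = det (a_ij) / det (b_kl)`. -/
noncomputable def vSol {m : ℕ} (X T : Fin m → 𝕜 → 𝕜) (n : ℕ) (x t : 𝕜) : 𝕜 :=
  detA X T n x t / detB X T n x t

/-- The Möbius map with `0 ↦ a`, `∞ ↦ b`. -/
noncomputable def mobius (a b v : 𝕜) : 𝕜 := (a - b) * v / (a - b - v) + a

/-- The denominator of the Möbius map `mobius a b` at the point `[det (a_ij) : det (b_kl)]` of the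
projective line. It is nonzero exactly if this is a well-defined point with finite image. -/
noncomputable def phiDen {m : ℕ} (a b : 𝕜) (X T : Fin m → 𝕜 → 𝕜) (n : ℕ) (x t : 𝕜) : 𝕜 :=
  (a - b) * detB X T n x t - detA X T n x t

/-- The image of `v_n = [det (a_ij) : det (b_kl)]` under `mobius a b`, in homogeneous form, so that it
also makes sense where `det (b_kl) = 0`, i.e. `v_n = ∞`. -/
noncomputable def phiSol {m : ℕ} (a b : 𝕜) (X T : Fin m → 𝕜 → 𝕜) (n : ℕ) (x t : 𝕜) : 𝕜 :=
  (a - b) * detA X T n x t / phiDen a b X T n x t + a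

end FSY

open scoped ContDiff

namespace FSY

/-! ### Nested leading blocks: bordered inverses and Schur complements -/

section Algebra

variable {K : Type*}

/-! Put u = 1/(v_1 - v_0) and let M_n be the leading n × n block of the array of partial derivatives
∂ₓⁱ∂ₜʲu. The candidate for v_n - v_0 is the corner entry of the inverse of M_n, and two computations
meet in it.

Algebraically, let S be the Schur complement of M_n in M_{n+1}, and let P and Q be the entries at 0
of `colCoef` and `rowCoef`. Bordering gives v_{n+1} - v_n = PQ/S (`inv_gram_succ_corner`).
Analytically, a derivative shifts the rows or the columns of the array by one, so derivatives of the
inverse involve only its last row and column together with P, Q, S (`Tower.deriv_formulas`). The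
lattice equation at site n thereby reduces to PQ/(v_{n+1} - v_n) = S (`Tower.equation_iff`). So the
quotients of determinants satisfy it at every interior site (`Tower.isSolution`). Conversely v_1
determines all later sites, and nondegeneracy, which says P, Q ≠ 0, keeps the successive
determinants nonzero (`IsSolution.exists_tower`).

Only the last site is left. For v_N = ∞ it demands S = 0, that is, det M_N = 0 with M_{N-1}
invertible. This holds when u is a sum of N - 1 products X_s T_s, by rank, and it forces u to be
such a sum, by a linear ODE argument (`Tower.exists_kernel`). For v_N = b, adding the constant 1/(a
- b) to u moves b to ∞ and leads to the same condition (`det_gram_bump_eq_zero_iff`). -/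

/-- The leading `n × n` block of an infinite matrix. -/
def gram (e : ℕ → ℕ → K) (n : ℕ) : Matrix (Fin n) (Fin n) K := Matrix.of fun i j => e i j

@[simp] lemma gram_apply (e : ℕ → ℕ → K) (n : ℕ) (i j : Fin n) : gram e n i j = e i j := rfl

lemma gram_flip (e : ℕ → ℕ → K) (n : ℕ) :
    gram (fun i j => e j i) n = (gram e n).transpose := rfl

variable [Field K]

/-- The minor of `gram e (m + 1)` obtained by deleting the first row and the first column. -/
def coreMinor (e : ℕ → ℕ → K) (m : ℕ) : K := (gram (fun i j => e (i + 1) (j + 1)) m).det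

/-- The coefficients of column `m + 1` in terms of the columns `0, …, m` of the leading block. -/
noncomputable def colCoef (e : ℕ → ℕ → K) (m : ℕ) : Fin (m + 1) → K :=
  Matrix.mulVec (gram e (m + 1))⁻¹ fun i => e i (m + 1)

/-- The coefficients of row `m + 1` in terms of the rows `0, …, m` of the leading block. -/
noncomputable def rowCoef (e : ℕ → ℕ → K) (m : ℕ) : Fin (m + 1) → K :=
  colCoef (fun i j => e j i) m

/-- The Schur complement of the leading block of size `m + 1` in the one of size `m + 2`. -/
noncomputable def schur (e : ℕ → ℕ → K) (m : ℕ) : K :=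
  e (m + 1) (m + 1) - ∑ j : Fin (m + 1), e (m + 1) j * colCoef e m j

/-- Adding `c` to the `k`-th diagonal entry. -/
def bump (k : ℕ) (c : K) (e : ℕ → ℕ → K) (i j : ℕ) : K := e i j + if i = k ∧ j = k then c else 0

lemma det_gram_flip (e : ℕ → ℕ → K) (n : ℕ) :
    (gram (fun i j => e j i) n).det = (gram e n).det := by
  rw [gram_flip, Matrix.det_transpose]

lemma inv_gram_flip (e : ℕ → ℕ → K) (n : ℕ) (i j : Fin n) :
    (gram (fun i j => e j i) n)⁻¹ i j = (gram e n)⁻¹ j i := by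
  rw [gram_flip, ← Matrix.transpose_nonsing_inv, Matrix.transpose_apply]

lemma sum_gram_mul_inv {e : ℕ → ℕ → K} {n : ℕ} (h : (gram e n).det ≠ 0) (i k : Fin n) :
    ∑ j : Fin n, e i j * (gram e n)⁻¹ j k = if i = k then 1 else 0 := by
  have := congrFun (congrFun (Matrix.mul_nonsing_inv (gram e n) (isUnit_iff_ne_zero.mpr h)) i) k
  rwa [Matrix.mul_apply, Matrix.one_apply] at this

lemma gram_mulVec_colCoef {e : ℕ → ℕ → K} {m : ℕ} (h : (gram e (m + 1)).det ≠ 0)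
    (i : Fin (m + 1)) : ∑ j : Fin (m + 1), e i j * colCoef e m j = e i (m + 1) := by
  have : Matrix.mulVec (gram e (m + 1)) (colCoef e m) = fun i : Fin (m + 1) => e i (m + 1) := by
    rw [colCoef, Matrix.mulVec_mulVec, Matrix.mul_nonsing_inv _ (isUnit_iff_ne_zero.mpr h),
      Matrix.one_mulVec]
  exact congrFun this i

lemma sum_rowCoef_mul {e : ℕ → ℕ → K} {m : ℕ} (h : (gram e (m + 1)).det ≠ 0)
    (j : Fin (m + 1)) : ∑ i, rowCoef e m i * e i j = e (m + 1) j := by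
  rw [← gram_mulVec_colCoef (e := fun i j => e j i) (by rwa [det_gram_flip]) j]
  exact Finset.sum_congr rfl fun i _ => mul_comm _ _

lemma rowCoef_eq (e : ℕ → ℕ → K) (m : ℕ) (k : Fin (m + 1)) :
    rowCoef e m k = ∑ j : Fin (m + 1), e (m + 1) j * (gram e (m + 1))⁻¹ j k := by
  simp only [rowCoef, colCoef, Matrix.mulVec, dotProduct, inv_gram_flip]
  exact Finset.sum_congr rfl fun i _ => mul_comm _ _

lemma colCoef_eq (e : ℕ → ℕ → K) (m : ℕ) (k : Fin (m + 1)) :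
    colCoef e m k = ∑ j : Fin (m + 1), (gram e (m + 1))⁻¹ k j * e j (m + 1) := rfl

lemma schur_eq_sub_sum_rowCoef (e : ℕ → ℕ → K) (m : ℕ) :
    schur e m = e (m + 1) (m + 1) - ∑ i : Fin (m + 1), rowCoef e m i * e i (m + 1) := by
  simp only [schur, rowCoef_eq, colCoef_eq, Finset.mul_sum, Finset.sum_mul]
  rw [Finset.sum_comm]
  simp only [mul_assoc]

lemma schur_flip (e : ℕ → ℕ → K) (m : ℕ) : schur (fun i j => e j i) m = schur e m := by
  rw [schur_eq_sub_sum_rowCoef e, schur]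
  congr 1
  exact Finset.sum_congr rfl fun i _ => mul_comm _ _

lemma inv_col_eq {e : ℕ → ℕ → K} {n : ℕ} (h : (gram e n).det ≠ 0) (k : Fin n) (y : Fin n → K)
    (hy : ∀ i : Fin n, ∑ j : Fin n, e i j * y j = if i = k then 1 else 0) (j : Fin n) :
    (gram e n)⁻¹ j k = y j := by
  have h1 : Matrix.mulVec (gram e n) y = Pi.single k 1 := by
    ext i
    rw [Pi.single_apply]
    exact hy i
  have h2 : y = Matrix.mulVec (gram e n)⁻¹ (Pi.single k 1) := by
    rw [← h1, Matrix.mulVec_mulVec, Matrix.nonsing_inv_mul _ (isUnit_iff_ne_zero.mpr h),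
      Matrix.one_mulVec]
  rw [h2, Matrix.mulVec_single_one, Matrix.col_apply]

lemma adjugate_gram_zero (e : ℕ → ℕ → K) (m : ℕ) :
    (gram e (m + 1)).adjugate 0 0 = coreMinor e m := by
  rw [Matrix.adjugate_fin_succ_eq_det_submatrix]
  simp only [Fin.val_zero, add_zero, pow_zero, one_mul, Fin.succAbove_zero]
  rw [coreMinor]
  congr 1

lemma adjugate_gram_last (e : ℕ → ℕ → K) (m : ℕ) :
    (gram e (m + 1)).adjugate (Fin.last m) (Fin.last m) = (gram e m).det := by
  rw [Matrix.adjugate_fin_succ_eq_det_submatrix]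
  simp only [Fin.val_last, ← two_mul, pow_mul, neg_one_sq, one_pow, one_mul, Fin.succAbove_last]
  congr 1

lemma inv_gram_zero (e : ℕ → ℕ → K) (m : ℕ) :
    (gram e (m + 1))⁻¹ 0 0 = coreMinor e m / (gram e (m + 1)).det := by
  rw [Matrix.inv_def, Matrix.smul_apply, adjugate_gram_zero, Ring.inverse_eq_inv, smul_eq_mul,
    div_eq_inv_mul]

lemma det_gram_bump (e : ℕ → ℕ → K) {n : ℕ} (k : Fin n) (c : K) :
    (gram (bump k c e) n).det = (gram e n).det + c * (gram e n).adjugate k k := by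
  have : gram (bump k c e) n =
      (gram e n).updateRow k (gram e n k + c • Pi.single k 1) := by
    ext i j
    rw [Matrix.updateRow_apply]
    split_ifs with h
    · subst h
      simp [bump, Pi.single_apply, Fin.ext_iff]
    · simp [bump, Fin.val_inj, h]
  rw [this, Matrix.det_updateRow_add, Matrix.det_updateRow_smul, Matrix.updateRow_eq_self,
    Matrix.adjugate_apply]

lemma det_gram_bump_zero (e : ℕ → ℕ → K) (m : ℕ) (c : K) :
    (gram (bump 0 c e) (m + 1)).det = (gram e (m + 1)).det + c * coreMinor e m := by
  rw [← adjugate_gram_zero, ← det_gram_bump]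
  rfl

lemma coreMinor_bump_zero (e : ℕ → ℕ → K) (m : ℕ) (c : K) :
    coreMinor (bump 0 c e) m = coreMinor e m := by
  simp [coreMinor, bump]

lemma gram_bump_of_le (e : ℕ → ℕ → K) {n k : ℕ} (h : n ≤ k) (c : K) :
    gram (bump k c e) n = gram e n := by
  ext i j
  have : (i : ℕ) ≠ k := by omega
  simp [bump, this]

lemma coreMinor_bump_last (e : ℕ → ℕ → K) (m : ℕ) (c : K) :
    coreMinor (bump (m + 1) c e) (m + 1) = coreMinor e (m + 1) + c * coreMinor e m := by
  have h := det_gram_bump (fun i j => e (i + 1) (j + 1)) (Fin.last m) c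
  rw [adjugate_gram_last] at h
  simp only [coreMinor]
  rw [← h]
  congr 2
  ext i j
  simp [bump]

lemma colCoef_bump_last (e : ℕ → ℕ → K) (m : ℕ) (c : K) :
    colCoef (bump (m + 1) c e) m = colCoef e m := by
  rw [colCoef, gram_bump_of_le _ le_rfl, colCoef]
  congr 1
  ext i
  have : (i : ℕ) ≠ m + 1 := by omega
  simp [bump, this]

lemma rowCoef_bump_last (e : ℕ → ℕ → K) (m : ℕ) (c : K) :
    rowCoef (bump (m + 1) c e) m = rowCoef e m := by
  have : (fun i j => bump (m + 1) c e j i) = bump (m + 1) c fun i j => e j i := by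
    ext i j
    simp [bump, and_comm]
  rw [rowCoef, this, colCoef_bump_last, rowCoef]

lemma schur_bump_last (e : ℕ → ℕ → K) (m : ℕ) (c : K) :
    schur (bump (m + 1) c e) m = schur e m + c := by
  rw [schur, colCoef_bump_last, schur]
  have (j : Fin (m + 1)) : bump (m + 1) c e (m + 1) j = e (m + 1) j := by
    have : (j : ℕ) ≠ m + 1 := by omega
    simp [bump, this]
  simp only [this]
  simp [bump]
  ring

/-- Schur's determinant formula for a block matrix with a 1 × 1 lower right corner. -/
lemma det_gram_succ {e : ℕ → ℕ → K} {m : ℕ} (h : (gram e (m + 1)).det ≠ 0) :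
    (gram e (m + 2)).det = (gram e (m + 1)).det * schur e m := by
  have := Matrix.invertibleOfIsUnitDet (gram e (m + 1)) (isUnit_iff_ne_zero.mpr h)
  have h1 := Matrix.det_fromBlocks₁₁ (gram e (m + 1))
    (Matrix.of fun (i : Fin (m + 1)) (_ : Fin 1) => e i (m + 1))
    (Matrix.of fun (_ : Fin 1) (j : Fin (m + 1)) => e (m + 1) j)
    (Matrix.of fun (_ _ : Fin 1) => e (m + 1) (m + 1))
  rw [Matrix.det_fin_one, Matrix.invOf_eq_nonsing_inv] at h1
  convert h1 using 1
  · rw [← Matrix.det_reindex_self (finSumFinEquiv (m := m + 1) (n := 1))]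
    congr 1
    ext i j
    refine Fin.lastCases ?_ (fun i => ?_) i <;> refine Fin.lastCases ?_ (fun j => ?_) j <;>
      simp [gram]
  · congr 1
    simp only [schur, Matrix.sub_apply, Matrix.of_apply, Matrix.mul_assoc]
    rw [Matrix.mul_apply]
    rfl

lemma det_gram_succ_ne_zero {e : ℕ → ℕ → K} {m : ℕ} (h : (gram e (m + 1)).det ≠ 0)
    (hs : schur e m ≠ 0) : (gram e (m + 2)).det ≠ 0 := by
  rw [det_gram_succ h]
  exact mul_ne_zero h hs

/-- The vector (-`colCoef`, 1) is annihilated by the old rows and takes the value `schur` on the new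
one. -/
lemma inv_gram_succ_last {e : ℕ → ℕ → K} {m : ℕ} (h : (gram e (m + 1)).det ≠ 0)
    (hs : schur e m ≠ 0) (j : Fin (m + 2)) :
    (gram e (m + 2))⁻¹ j (Fin.last (m + 1)) =
      Fin.lastCases (motive := fun _ => K) (schur e m)⁻¹
        (fun k => -colCoef e m k / schur e m) j := by
  refine inv_col_eq (det_gram_succ_ne_zero h hs) _ _ (fun i => ?_) j
  rw [Fin.sum_univ_castSucc]
  simp only [Fin.lastCases_castSucc, Fin.lastCases_last, Fin.val_castSucc, Fin.val_last]
  have h0 : ∑ k : Fin (m + 1), e i k * (-colCoef e m k / schur e m) =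
      -(∑ k : Fin (m + 1), e i k * colCoef e m k) / schur e m := by
    rw [← Finset.sum_neg_distrib, Finset.sum_div]
    exact Finset.sum_congr rfl fun k _ => by ring
  rw [h0]
  refine Fin.lastCases ?_ (fun i => ?_) i
  · have : ∑ k : Fin (m + 1), e (m + 1) k * colCoef e m k = e (m + 1) (m + 1) - schur e m := by
      rw [schur]; ring
    simp only [Fin.val_last, this, if_true]
    field_simp
    ring
  · rw [Fin.val_castSucc, gram_mulVec_colCoef h i, if_neg (Fin.castSucc_lt_last i).ne]
    ring

/-- The old column padded by 0 fits the old rows but gives `rowCoef e m 0` on the new row.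
Subtracting that multiple of the last column of the new inverse corrects this. -/
lemma inv_gram_succ_zero {e : ℕ → ℕ → K} {m : ℕ} (h : (gram e (m + 1)).det ≠ 0)
    (hs : schur e m ≠ 0) (j : Fin (m + 2)) :
    (gram e (m + 2))⁻¹ j 0 =
      Fin.lastCases (motive := fun _ => K) (-rowCoef e m 0 / schur e m)
        (fun k => (gram e (m + 1))⁻¹ k 0 + colCoef e m k * rowCoef e m 0 / schur e m) j := by
  refine inv_col_eq (det_gram_succ_ne_zero h hs) _ _ (fun i => ?_) j
  rw [Fin.sum_univ_castSucc]
  simp only [Fin.lastCases_castSucc, Fin.lastCases_last, Fin.val_castSucc, Fin.val_last]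
  have h0 : ∑ k : Fin (m + 1), e i k *
        ((gram e (m + 1))⁻¹ k 0 + colCoef e m k * rowCoef e m 0 / schur e m) =
      ∑ k : Fin (m + 1), e i k * (gram e (m + 1))⁻¹ k 0 +
        (∑ k : Fin (m + 1), e i k * colCoef e m k) * (rowCoef e m 0 / schur e m) := by
    rw [Finset.sum_mul, ← Finset.sum_add_distrib]
    exact Finset.sum_congr rfl fun k _ => by ring
  rw [h0]
  refine Fin.lastCases ?_ (fun i => ?_) i
  · have : ∑ k : Fin (m + 1), e (m + 1) k * colCoef e m k = e (m + 1) (m + 1) - schur e m := by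
      rw [schur]; ring
    rw [Fin.val_last, this, ← rowCoef_eq, if_neg (Fin.last_pos.ne')]
    field_simp
    ring
  · rw [Fin.val_castSucc, gram_mulVec_colCoef h i, sum_gram_mul_inv h]
    have : (i.castSucc = 0) ↔ i = 0 := Fin.castSucc_eq_zero_iff
    simp only [this]
    ring

lemma inv_gram_succ_corner {e : ℕ → ℕ → K} {m : ℕ} (h : (gram e (m + 1)).det ≠ 0)
    (hs : schur e m ≠ 0) :
    (gram e (m + 2))⁻¹ 0 0 =
      (gram e (m + 1))⁻¹ 0 0 + colCoef e m 0 * rowCoef e m 0 / schur e m := by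
  rw [inv_gram_succ_zero h hs]
  exact Fin.lastCases_castSucc (n := m + 1) (i := 0) ..

/-- The numerators obey a three-term recurrence, also where the Schur complement vanishes. -/
lemma coreMinor_succ {e : ℕ → ℕ → K} {m : ℕ} (h : (gram e (m + 1)).det ≠ 0) :
    coreMinor e (m + 1) = (gram e (m + 1)).det *
      ((gram e (m + 1))⁻¹ 0 0 * schur e m + colCoef e m 0 * rowCoef e m 0) := by
  -- Changing the last diagonal entry makes the Schur complement 1 and leaves the smaller block and
  -- the coefficients untouched. The numerator depends affinely on that entry, so the corner formula
  -- for the changed array gives back the claim.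
  have h1 : (gram (bump (m + 1) (1 - schur e m) e) (m + 1)).det ≠ 0 := by
    rwa [gram_bump_of_le _ le_rfl]
  have h2 : schur (bump (m + 1) (1 - schur e m) e) m = 1 := by rw [schur_bump_last]; ring
  have h3 := inv_gram_succ_corner h1 (by rw [h2]; exact one_ne_zero)
  rw [inv_gram_zero, det_gram_succ h1, h2, gram_bump_of_le _ le_rfl, colCoef_bump_last,
    rowCoef_bump_last, coreMinor_bump_last, inv_gram_zero] at h3
  rw [inv_gram_zero]
  field_simp at h3 ⊢
  linear_combination h3

/-- The difference of consecutive quotients `v_{m+1} - v_m`. -/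
lemma inv_gram_sub_of_succ {e : ℕ → ℕ → K} {m : ℕ} (h : (gram e (m + 1)).det ≠ 0)
    (h' : (gram e (m + 2)).det ≠ 0) :
    (gram e (m + 2))⁻¹ (Fin.last _) (Fin.last _) ≠ 0 ∧
    (gram e (m + 2))⁻¹ 0 0 - (gram e (m + 1))⁻¹ 0 0 =
      (gram e (m + 2))⁻¹ 0 (Fin.last _) * (gram e (m + 2))⁻¹ (Fin.last _) 0 /
        (gram e (m + 2))⁻¹ (Fin.last _) (Fin.last _) := by
  have hs : schur e m ≠ 0 := fun h0 => h' (by rw [det_gram_succ h, h0, mul_zero])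
  rw [inv_gram_succ_corner h hs, inv_gram_succ_zero h hs, inv_gram_succ_last h hs,
    inv_gram_succ_last h hs, Fin.lastCases_last, Fin.lastCases_last]
  have : Fin.lastCases (motive := fun _ => K) (schur e m)⁻¹
        (fun k => -colCoef e m k / schur e m) (0 : Fin (m + 2)) = -colCoef e m 0 / schur e m :=
    Fin.lastCases_castSucc (n := m + 1) (i := 0) ..
  rw [this]
  refine ⟨inv_ne_zero hs, ?_⟩
  field_simp
  ring

lemma inv_gram_one (e : ℕ → ℕ → K) (i j : Fin 1) : (gram e 1)⁻¹ i j = (e 0 0)⁻¹ := by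
  have hi : i = 0 := Subsingleton.elim _ _
  have hj : j = 0 := Subsingleton.elim _ _
  subst hi hj
  rw [inv_gram_zero]
  simp [coreMinor]

end Algebra

variable {𝕜 : Type*} [RCLike 𝕜]

/-! ### Derivatives of inverse blocks -/

section InverseDerivative

attribute [local instance] Matrix.linftyOpNormedRing Matrix.linftyOpNormedAlgebra
  Matrix.linftyOpNormedAddCommGroup Matrix.linftyOpNormedSpace

/-- The local norm serves only to make matrices a complete normed algebra, where the derivative of
the ring inverse is known; the conclusion is entrywise. -/
lemma hasDerivAt_matrix_inv {n : ℕ} {F : 𝕜 → Matrix (Fin n) (Fin n) 𝕜}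
    {F' : Matrix (Fin n) (Fin n) 𝕜} {x : 𝕜} (hF : ∀ i j, HasDerivAt (fun y => F y i j) (F' i j) x)
    (hd : (F x).det ≠ 0) (i j : Fin n) :
    HasDerivAt (fun y => (F y)⁻¹ i j) (-((F x)⁻¹ * F' * (F x)⁻¹) i j) x := by
  have hF1 : HasDerivAt F F' x := by
    refine hasDerivAt_pi.2 fun i => hasDerivAt_pi.2 fun j => hF i j
  have hu : IsUnit (F x) := (Matrix.isUnit_iff_isUnit_det _).2 (isUnit_iff_ne_zero.2 hd)
  obtain ⟨u, hu⟩ := hu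
  have h1 := hasFDerivAt_ringInverse (𝕜 := 𝕜) u
  rw [hu] at h1
  have h2 := h1.comp_hasDerivAt x hF1
  have h3 : HasDerivAt (fun y => (F y)⁻¹) (-((F x)⁻¹ * F' * (F x)⁻¹)) x := by
    have e1 : (Ring.inverse ∘ F) = fun y => (F y)⁻¹ := by
      ext1 y
      rw [Matrix.nonsing_inv_eq_ringInverse]
      rfl
    have e2 : (↑u⁻¹ : Matrix (Fin n) (Fin n) 𝕜) = (F x)⁻¹ := by
      rw [Matrix.coe_units_inv, hu]
    rw [e1] at h2
    refine h2.congr_deriv ?_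
    rw [e2]
    simp [ContinuousLinearMap.mulLeftRight_apply]
  exact hasDerivAt_pi.1 (hasDerivAt_pi.1 h3 i) j

end InverseDerivative

lemma hasDerivAt_inv_gram {a : ℕ → ℕ → 𝕜 → 𝕜} {x : 𝕜} {m : ℕ}
    (ha : ∀ i j, HasDerivAt (a i j) (a (i + 1) j x) x)
    (hd : (gram (fun i j => a i j x) (m + 1)).det ≠ 0) (k l : Fin (m + 1)) :
    HasDerivAt (fun y => (gram (fun i j => a i j y) (m + 1))⁻¹ k l)
      (-∑ i, (gram (fun i j => a i j x) (m + 1))⁻¹ k i *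
        ∑ j : Fin (m + 1), a (i + 1) j x * (gram (fun i j => a i j x) (m + 1))⁻¹ j l) x := by
  have := hasDerivAt_matrix_inv (F := fun y => gram (fun i j => a i j y) (m + 1))
    (F' := gram (fun i j => a (i + 1) j x) (m + 1)) (fun i j => ha i j) hd k l
  convert this using 2
  rw [Matrix.mul_assoc, Matrix.mul_apply]
  rfl

/-- Shifting the rows of the leading block by one, only the last row is new. -/
lemma sum_shift_mul {K : Type*} [Field K] {e : ℕ → ℕ → K} {m : ℕ} (w y : Fin (m + 1) → K)
    (c : ℕ → K) (hy : ∀ i : Fin (m + 1), ∑ j : Fin (m + 1), e i j * y j = c i) :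
    ∑ i : Fin (m + 1), w i * (c (i + 1) - ∑ j : Fin (m + 1), e (i + 1) j * y j) =
      w (Fin.last m) * (c (m + 1) - ∑ j : Fin (m + 1), e (m + 1) j * y j) := by
  rw [Fin.sum_univ_castSucc]
  simp only [Fin.val_castSucc, Fin.val_last]
  rw [Finset.sum_eq_zero, zero_add]
  intro i _
  have := hy i.succ
  rw [Fin.val_succ] at this
  rw [this, sub_self, mul_zero]

/-- The derivative of the block is the block shifted by one row. Applied to column 0 of the inverse
it gives the unit vector at 0 shifted upwards, which is zero, except in the last row, where a new
value `rowCoef _ m 0` enters. -/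
lemma hasDerivAt_inv_gram_zero {a : ℕ → ℕ → 𝕜 → 𝕜} {x : 𝕜} {m : ℕ}
    (ha : ∀ i j, HasDerivAt (a i j) (a (i + 1) j x) x)
    (hd : (gram (fun i j => a i j x) (m + 1)).det ≠ 0) (k : Fin (m + 1)) :
    HasDerivAt (fun y => (gram (fun i j => a i j y) (m + 1))⁻¹ k 0)
      (-((gram (fun i j => a i j x) (m + 1))⁻¹ k (Fin.last m) *
        rowCoef (fun i j => a i j x) m 0)) x := by
  refine (hasDerivAt_inv_gram ha hd k 0).congr_deriv (congrArg _ ?_)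
  have := sum_shift_mul (e := fun i j => a i j x) (m := m)
    (fun i => (gram (fun i j => a i j x) (m + 1))⁻¹ k i)
    (fun j => (gram (fun i j => a i j x) (m + 1))⁻¹ j 0) (fun i => if i = 0 then 1 else 0)
    (fun i => by
      rw [sum_gram_mul_inv hd]
      simp only [Fin.ext_iff, Fin.val_zero])
  simp only [Nat.add_eq_zero_iff, one_ne_zero, and_false, if_false, zero_sub, mul_neg,
    Finset.sum_neg_distrib, neg_inj] at this
  rw [rowCoef_eq]
  exact this

/-- The derivative of a vector `M⁻¹ c` for which `c` is shifted together with the rows of `M`. -/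
lemma hasDerivAt_inv_gram_mulVec {a : ℕ → ℕ → 𝕜 → 𝕜} {c : ℕ → 𝕜 → 𝕜} {x : 𝕜} {m : ℕ}
    (ha : ∀ i j, HasDerivAt (a i j) (a (i + 1) j x) x)
    (hc : ∀ i, HasDerivAt (c i) (c (i + 1) x) x)
    (hd : (gram (fun i j => a i j x) (m + 1)).det ≠ 0) (k : Fin (m + 1)) :
    HasDerivAt (fun y => ∑ j : Fin (m + 1), (gram (fun i j => a i j y) (m + 1))⁻¹ k j * c j y)
      ((gram (fun i j => a i j x) (m + 1))⁻¹ k (Fin.last m) *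
        (c (m + 1) x - ∑ i, rowCoef (fun i j => a i j x) m i * c i x)) x := by
  set W := (gram (fun i j => a i j x) (m + 1))⁻¹ with hW
  have h1 := HasDerivAt.fun_sum (u := Finset.univ) fun (j : Fin (m + 1)) _ =>
    (hasDerivAt_inv_gram ha hd k j).fun_mul (hc j)
  refine h1.congr_deriv ?_
  rw [← hW]
  have h2 := sum_shift_mul (e := fun i j => a i j x) (m := m) (fun i => W k i)
    (fun j => ∑ l : Fin (m + 1), W j l * c l x) (fun i => c i x)
    (fun i => by
      have h0 : Matrix.mulVec (gram (fun i j => a i j x) (m + 1))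
          (Matrix.mulVec W fun l => c l x) = fun l : Fin (m + 1) => c l x := by
        rw [Matrix.mulVec_mulVec, hW, Matrix.mul_nonsing_inv _ (isUnit_iff_ne_zero.mpr hd),
          Matrix.one_mulVec]
      exact congrFun h0 i)
  have h3 : ∑ i, rowCoef (fun i j => a i j x) m i * c i x =
      ∑ j : Fin (m + 1), a (m + 1) j x * ∑ l : Fin (m + 1), W j l * c l x := by
    simp only [rowCoef_eq, Finset.mul_sum, Finset.sum_mul, ← hW]
    rw [Finset.sum_comm]
    simp only [mul_assoc]
  rw [h3]
  refine Eq.trans ?_ h2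
  rw [Finset.sum_add_distrib]
  simp only [mul_sub, Finset.sum_sub_distrib, neg_mul, Finset.sum_neg_distrib]
  rw [sub_eq_neg_add]
  congr 2
  simp only [Finset.mul_sum, Finset.sum_mul]
  rw [Finset.sum_comm_cycle, Finset.sum_comm_cycle]
  simp only [mul_assoc]

/-- The residual in the new row is the Schur complement. Where that vanishes identically the
coefficients are therefore locally constant in the variable that shifts the rows. -/
lemma hasDerivAt_colCoef {a : ℕ → ℕ → 𝕜 → 𝕜} {x : 𝕜} {m : ℕ}
    (ha : ∀ i j, HasDerivAt (a i j) (a (i + 1) j x) x)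
    (hd : (gram (fun i j => a i j x) (m + 1)).det ≠ 0) (k : Fin (m + 1)) :
    HasDerivAt (fun y => colCoef (fun i j => a i j y) m k)
      ((gram (fun i j => a i j x) (m + 1))⁻¹ k (Fin.last m) * schur (fun i j => a i j x) m) x := by
  rw [schur_eq_sub_sum_rowCoef]
  exact hasDerivAt_inv_gram_mulVec ha (fun i => ha i (m + 1)) hd k

/-! ### Towers of partial derivatives -/

/-- A family `a i j` of functions on `I × J` with `∂ₓ (a i j) = a (i+1) j` and
`∂ₜ (a i j) = a i (j+1)`, that is, all the partial derivatives of `a 0 0`. -/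
structure Tower (I J : Set 𝕜) (a : ℕ → ℕ → 𝕜 → 𝕜 → 𝕜) : Prop where
  hasDerivAt_fst : ∀ i j, ∀ x ∈ I, ∀ t ∈ J, HasDerivAt (fun y => a i j y t) (a (i + 1) j x t) x
  hasDerivAt_snd : ∀ i j, ∀ x ∈ I, ∀ t ∈ J, HasDerivAt (fun s => a i j x s) (a i (j + 1) x t) t

namespace Tower

variable {I J : Set 𝕜} {a b : ℕ → ℕ → 𝕜 → 𝕜 → 𝕜}

lemma bump (ha : Tower I J a) (c : 𝕜) :
    Tower I J fun i j x t => bump 0 c (fun i j => a i j x t) i j := by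
  constructor
  · intro i j x hx t ht
    refine ((ha.hasDerivAt_fst i j x hx t ht).add_const
      (if i = 0 ∧ j = 0 then c else 0)).congr_deriv ?_
    simp [FSY.bump]
  · intro i j x hx t ht
    refine ((ha.hasDerivAt_snd i j x hx t ht).add_const
      (if i = 0 ∧ j = 0 then c else 0)).congr_deriv ?_
    simp [FSY.bump]

lemma eq_of_eq_zero (hI : IsOpen I) (hJ : IsOpen J) (ha : Tower I J a) (hb : Tower I J b)
    (h : ∀ x ∈ I, ∀ t ∈ J, a 0 0 x t = b 0 0 x t) (i j : ℕ) :
    ∀ x ∈ I, ∀ t ∈ J, a i j x t = b i j x t := by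
  induction i with
  | zero =>
    induction j with
    | zero => exact h
    | succ j ih =>
      intro x hx t ht
      refine (ha.hasDerivAt_snd 0 j x hx t ht).unique
        ((hb.hasDerivAt_snd 0 j x hx t ht).congr_of_eventuallyEq ?_)
      filter_upwards [hJ.mem_nhds ht] with s hs using ih x hx s hs
  | succ i ih =>
    intro x hx t ht
    refine (ha.hasDerivAt_fst i j x hx t ht).unique
      ((hb.hasDerivAt_fst i j x hx t ht).congr_of_eventuallyEq ?_)
    filter_upwards [hI.mem_nhds hx] with y hy using ih y hy t ht

/-- The first derivatives and the mixed second derivative of `v = (M⁻¹)₀₀`, where `M` is a leading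
block of the matrix of partial derivatives. -/
lemma deriv_formulas (hI : IsOpen I) (hJ : IsOpen J) (ha : Tower I J a) {m : ℕ}
    (hd : ∀ x ∈ I, ∀ t ∈ J, (gram (fun i j => a i j x t) (m + 1)).det ≠ 0)
    {f : 𝕜 → 𝕜 → 𝕜} {r : 𝕜}
    (hf : ∀ x ∈ I, ∀ t ∈ J, f x t = (gram (fun i j => a i j x t) (m + 1))⁻¹ 0 0 + r)
    {x t : 𝕜} (hx : x ∈ I) (ht : t ∈ J) :
    let e : ℕ → ℕ → 𝕜 := fun i j => a i j x t
    let W := (gram e (m + 1))⁻¹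
    dx f x t = -(W 0 (Fin.last m) * rowCoef e m 0) ∧
    dt f x t = -(W (Fin.last m) 0 * colCoef e m 0) ∧
    dx (dt f) x t = W (Fin.last m) (Fin.last m) * (colCoef e m 0 * rowCoef e m 0) -
      W 0 (Fin.last m) * W (Fin.last m) 0 * schur e m := by
  -- The `t`-derivative is the row-shift formula for the transposed array, in which `rowCoef`
  -- becomes `colCoef`. It is needed for all `y` in `I`, since it is differentiated in `x` below.
  have hT : ∀ y ∈ I, dt f y t = -((gram (fun i j => a i j y t) (m + 1))⁻¹ (Fin.last m) 0 *
      colCoef (fun i j => a i j y t) m 0) := by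
    intro y hy
    have h1 := (hasDerivAt_inv_gram_zero (a := fun i j s => a j i y s) (x := t) (m := m)
      (fun i j => ha.hasDerivAt_snd j i y hy t ht)
      (by rw [det_gram_flip (fun i j => a i j y t)]; exact hd y hy t ht) 0).add_const r
    have h2 : HasDerivAt (fun s => f y s) _ t := h1.congr_of_eventuallyEq (by
      filter_upwards [hJ.mem_nhds ht] with s hs
      rw [hf y hy s hs, inv_gram_flip (fun i j => a i j y s)])
    rw [dt, h2.deriv, inv_gram_flip (fun i j => a i j y t)]
    rfl
  intro e W
  refine ⟨?_, hT x hx, ?_⟩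
  · have h1 := (hasDerivAt_inv_gram_zero (a := fun i j y => a i j y t) (x := x) (m := m)
      (fun i j => ha.hasDerivAt_fst i j x hx t ht) (hd x hx t ht) 0).add_const r
    have h2 : HasDerivAt (fun y => f y t) _ x := h1.congr_of_eventuallyEq (by
      filter_upwards [hI.mem_nhds hx] with y hy using hf y hy t ht)
    exact h2.deriv
  · have h1 := hasDerivAt_inv_gram_zero (a := fun i j y => a i j y t) (x := x) (m := m)
      (fun i j => ha.hasDerivAt_fst i j x hx t ht) (hd x hx t ht) (Fin.last m)
    have h2 := hasDerivAt_colCoef (a := fun i j y => a i j y t) (x := x) (m := m)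
      (fun i j => ha.hasDerivAt_fst i j x hx t ht) (hd x hx t ht) 0
    have h3 : HasDerivAt (fun y => dt f y t) _ x := (h1.fun_mul h2).fun_neg.congr_of_eventuallyEq (by
      filter_upwards [hI.mem_nhds hx] with y hy using hT y hy)
    rw [dx, h3.deriv]
    ring

end Tower

/-! ### Separable kernels: smoothness, rank and factorisation -/

lemma contDiffOn_of_hasDerivAt_succ {I : Set 𝕜} (hI : IsOpen I) {f : ℕ → 𝕜 → 𝕜}
    (hf : ∀ i, ∀ x ∈ I, HasDerivAt (f i) (f (i + 1) x) x) (i : ℕ) : ContDiffOn 𝕜 ∞ (f i) I := by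
  rw [contDiffOn_infty]
  intro n
  induction n generalizing i with
  | zero => exact contDiffOn_zero.2 fun x hx => (hf i x hx).continuousAt.continuousWithinAt
  | succ n ih =>
    rw [Nat.cast_add, Nat.cast_one]
    refine (contDiffOn_succ_iff_deriv_of_isOpen hI).2 ⟨fun x hx =>
      (hf i x hx).differentiableAt.differentiableWithinAt,
      fun h => (WithTop.coe_ne_top h).elim, ?_⟩
    exact (ih (i + 1)).congr fun x hx => (hf i x hx).deriv

lemma contDiffOn_iteratedDeriv {I : Set 𝕜} (hI : IsOpen I) {f : 𝕜 → 𝕜} (hf : ContDiffOn 𝕜 ∞ f I)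
    (n : ℕ) : ContDiffOn 𝕜 ∞ (iteratedDeriv n f) I := by
  induction n with
  | zero => simpa using hf
  | succ n ih =>
    rw [iteratedDeriv_succ]
    exact ((contDiffOn_infty_iff_deriv_of_isOpen hI).1 ih).2

lemma hasDerivAt_iteratedDeriv {I : Set 𝕜} (hI : IsOpen I) {f : 𝕜 → 𝕜} (hf : ContDiffOn 𝕜 ∞ f I)
    (n : ℕ) {x : 𝕜} (hx : x ∈ I) :
    HasDerivAt (iteratedDeriv n f) (iteratedDeriv (n + 1) f x) x := by
  rw [iteratedDeriv_succ]
  exact (((contDiffOn_iteratedDeriv hI hf n).differentiableOn (by simp)).differentiableAt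
    (hI.mem_nhds hx)).hasDerivAt

/-- The partial derivatives of the kernel `∑ s, X_s(x) T_s(t)`. -/
noncomputable def kernelDeriv {m : ℕ} (X T : Fin m → 𝕜 → 𝕜) (i j : ℕ) (x t : 𝕜) : 𝕜 :=
  ∑ s, iteratedDeriv i (X s) x * iteratedDeriv j (T s) t

lemma tower_kernelDeriv {I J : Set 𝕜} (hI : IsOpen I) (hJ : IsOpen J) {m : ℕ}
    {X T : Fin m → 𝕜 → 𝕜} (hX : ∀ s, ContDiffOn 𝕜 ∞ (X s) I) (hT : ∀ s, ContDiffOn 𝕜 ∞ (T s) J) :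
    Tower I J (kernelDeriv X T) := by
  constructor
  · intro i j x hx t _
    exact HasDerivAt.fun_sum fun s _ => (hasDerivAt_iteratedDeriv hI (hX s) i hx).mul_const _
  · intro i j x _ t ht
    exact HasDerivAt.fun_sum fun s _ => (hasDerivAt_iteratedDeriv hJ (hT s) j ht).const_mul _

lemma detB_eq {m : ℕ} (X T : Fin m → 𝕜 → 𝕜) (n : ℕ) (x t : 𝕜) :
    detB X T n x t = (gram (fun i j => kernelDeriv X T i j x t) n).det := rfl

lemma detA_succ_eq {m : ℕ} (X T : Fin m → 𝕜 → 𝕜) (n : ℕ) (x t : 𝕜) :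
    detA X T (n + 1) x t = coreMinor (fun i j => kernelDeriv X T i j x t) n := rfl

/-- The matrix factors through an `m`-dimensional space. -/
lemma detB_succ_eq_zero {m : ℕ} (X T : Fin m → 𝕜 → 𝕜) (x t : 𝕜) : detB X T (m + 1) x t = 0 := by
  let A : Matrix (Fin (m + 1)) (Fin m) 𝕜 := Matrix.of fun k s => iteratedDeriv k (X s) x
  let B : Matrix (Fin m) (Fin (m + 1)) 𝕜 := Matrix.of fun s l => iteratedDeriv l (T s) t
  have h : detB X T (m + 1) x t = (A * B).det := rfl
  rw [h]
  by_contra h0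
  have h1 := Matrix.rank_of_isUnit (A * B)
    ((Matrix.isUnit_iff_isUnit_det _).2 (isUnit_iff_ne_zero.2 h0))
  have h2 := (Matrix.rank_mul_le_left A B).trans (Matrix.rank_le_width A)
  rw [Fintype.card_fin] at h1
  omega

lemma contDiffOn_det {E : Type*} [NormedAddCommGroup E] [NormedSpace 𝕜 E] {n : ℕ} {s : Set E}
    {M : E → Matrix (Fin n) (Fin n) 𝕜} (hM : ∀ i j, ContDiffOn 𝕜 ∞ (fun p => M p i j) s) :
    ContDiffOn 𝕜 ∞ (fun p => (M p).det) s := by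
  simp only [Matrix.det_apply]
  refine ContDiffOn.sum fun σ _ => ContDiffOn.const_smul _ ?_
  exact contDiffOn_prod fun i _ => hM _ _

lemma contDiffOn_kernelDeriv {I J : Set 𝕜} (hI : IsOpen I) (hJ : IsOpen J) {m : ℕ}
    {X T : Fin m → 𝕜 → 𝕜} (hX : ∀ s, ContDiffOn 𝕜 ∞ (X s) I) (hT : ∀ s, ContDiffOn 𝕜 ∞ (T s) J)
    (i j : ℕ) : ContDiffOn 𝕜 ∞ (fun p : 𝕜 × 𝕜 => kernelDeriv X T i j p.1 p.2) (I ×ˢ J) := by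
  refine ContDiffOn.sum fun s _ => ContDiffOn.mul ?_ ?_
  · exact (contDiffOn_iteratedDeriv hI (hX s) i).comp contDiffOn_fst fun p hp => hp.1
  · exact (contDiffOn_iteratedDeriv hJ (hT s) j).comp contDiffOn_snd fun p hp => hp.2

lemma contDiffOn_detB {I J : Set 𝕜} (hI : IsOpen I) (hJ : IsOpen J) {m : ℕ}
    {X T : Fin m → 𝕜 → 𝕜} (hX : ∀ s, ContDiffOn 𝕜 ∞ (X s) I) (hT : ∀ s, ContDiffOn 𝕜 ∞ (T s) J)
    (n : ℕ) : ContDiffOn 𝕜 ∞ (fun p : 𝕜 × 𝕜 => detB X T n p.1 p.2) (I ×ˢ J) :=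
  contDiffOn_det fun i j => contDiffOn_kernelDeriv hI hJ hX hT i j

lemma contDiffOn_detA {I J : Set 𝕜} (hI : IsOpen I) (hJ : IsOpen J) {m : ℕ}
    {X T : Fin m → 𝕜 → 𝕜} (hX : ∀ s, ContDiffOn 𝕜 ∞ (X s) I) (hT : ∀ s, ContDiffOn 𝕜 ∞ (T s) J)
    (n : ℕ) : ContDiffOn 𝕜 ∞ (fun p : 𝕜 × 𝕜 => detA X T n p.1 p.2) (I ×ˢ J) :=
  contDiffOn_det fun i j => contDiffOn_kernelDeriv hI hJ hX hT (i + 1) (j + 1)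

/-- If the matrix of partial derivatives of `a 0 0` has leading blocks of size `m + 1` invertible and
of size `m + 2` singular everywhere, then `a 0 0` is a sum of `m + 1` products. -/
lemma Tower.exists_kernel {I J : Set 𝕜} {a : ℕ → ℕ → 𝕜 → 𝕜 → 𝕜} (hI : IsOpen I)
    (hI' : IsPreconnected I) (hJ : IsOpen J) (hJ' : IsPreconnected J) (ha : Tower I J a) {m : ℕ}
    (hd : ∀ x ∈ I, ∀ t ∈ J, (gram (fun i j => a i j x t) (m + 1)).det ≠ 0)
    (hs : ∀ x ∈ I, ∀ t ∈ J, (gram (fun i j => a i j x t) (m + 2)).det = 0) :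
    ∃ X T : Fin (m + 1) → 𝕜 → 𝕜,
      (∀ s, ContDiffOn 𝕜 ∞ (X s) I) ∧ (∀ s, ContDiffOn 𝕜 ∞ (T s) J) ∧
      ∀ i j, ∀ x ∈ I, ∀ t ∈ J, a i j x t = kernelDeriv X T i j x t := by
  rcases I.eq_empty_or_nonempty with rfl | ⟨x₀, hx₀⟩
  · exact ⟨fun _ _ => 0, fun _ _ => 0, fun _ => contDiffOn_const, fun _ => contDiffOn_const,
      fun i j x hx => hx.elim⟩
  rcases J.eq_empty_or_nonempty with rfl | ⟨t₀, ht₀⟩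
  · exact ⟨fun _ _ => 0, fun _ _ => 0, fun _ => contDiffOn_const, fun _ => contDiffOn_const,
      fun i j x hx t ht => ht.elim⟩
  have hschur : ∀ x ∈ I, ∀ t ∈ J, schur (fun i j => a i j x t) m = 0 := fun x hx t ht => by
    have := hs x hx t ht
    rw [det_gram_succ (hd x hx t ht)] at this
    exact (mul_eq_zero.1 this).resolve_left (hd x hx t ht)
  -- The `t`-derivative of `rowCoef` is a multiple of the Schur complement, hence zero. So all
  -- functions `a 0 0 · t` solve one linear ODE of order `m + 1` in `x`, with coefficients
  -- independent of `t`.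
  have hrow : ∀ x ∈ I, ∀ t ∈ J, ∀ k,
      rowCoef (fun i j => a i j x t) m k = rowCoef (fun i j => a i j x t₀) m k := by
    intro x hx t ht k
    have hder : ∀ s ∈ J, HasDerivAt (fun s => rowCoef (fun i j => a i j x s) m k) 0 s := by
      intro s hs
      refine (hasDerivAt_colCoef (a := fun i j s => a j i x s) (x := s) (m := m)
        (fun i j => ha.hasDerivAt_snd j i x hx s hs)
        (by rw [det_gram_flip (fun i j => a i j x s)]; exact hd x hx s hs) k).congr_deriv ?_
      rw [schur_flip (fun i j => a i j x s), hschur x hx s hs, mul_zero]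
    exact hJ.is_const_of_deriv_eq_zero hJ'
      (fun s hs => (hder s hs).differentiableAt.differentiableWithinAt)
      (fun s hs => (hder s hs).deriv) ht ht₀
  -- The functions `a 0 s · t₀` are a fundamental system of that ODE, with the block at `t₀` as
  -- Wronskian matrix. Here `z` holds the coordinates of the solution `a 0 0 · t` in this system, so
  -- it does not depend on `x`.
  let z : Fin (m + 1) → 𝕜 → 𝕜 → 𝕜 := fun k x t =>
    ∑ j : Fin (m + 1), (gram (fun i j => a i j x t₀) (m + 1))⁻¹ k j * a j 0 x t
  have hz : ∀ x ∈ I, ∀ t ∈ J, ∀ k, z k x t = z k x₀ t := by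
    intro x hx t ht k
    have hder : ∀ y ∈ I, HasDerivAt (fun y => z k y t) 0 y := by
      intro y hy
      refine (hasDerivAt_inv_gram_mulVec (a := fun i j y => a i j y t₀) (c := fun i y => a i 0 y t)
        (fun i j => ha.hasDerivAt_fst i j y hy t₀ ht₀) (fun i => ha.hasDerivAt_fst i 0 y hy t ht)
        (hd y hy t₀ ht₀) k).congr_deriv ?_
      have h1 := sum_rowCoef_mul (hd y hy t ht) 0
      simp only [hrow y hy t ht, Fin.val_zero] at h1
      rw [h1, sub_self, mul_zero]
    exact hI.is_const_of_deriv_eq_zero hI'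
      (fun y hy => (hder y hy).differentiableAt.differentiableWithinAt)
      (fun y hy => (hder y hy).deriv) hx hx₀
  have hX : ∀ s : Fin (m + 1), ContDiffOn 𝕜 ∞ (fun x => a 0 s x t₀) I := fun s =>
    contDiffOn_of_hasDerivAt_succ hI (f := fun i x => a i s x t₀)
      (fun i x hx => ha.hasDerivAt_fst i s x hx t₀ ht₀) 0
  have hT : ∀ s : Fin (m + 1), ContDiffOn 𝕜 ∞ (fun t => z s x₀ t) J := fun s =>
    ContDiffOn.sum fun j _ => contDiffOn_const.mul
      (contDiffOn_of_hasDerivAt_succ hJ (f := fun i t => a j i x₀ t)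
        (fun i t ht => ha.hasDerivAt_snd j i x₀ hx₀ t ht) 0)
  -- By uniqueness of derivatives only the identity for `a 0 0` has to be checked; it is row 0 of
  -- the system defining `z`.
  refine ⟨fun s x => a 0 s x t₀, fun s t => z s x₀ t, hX, hT,
    ha.eq_of_eq_zero hI hJ (tower_kernelDeriv hI hJ hX hT) ?_⟩
  intro x hx t ht
  have h0 : Matrix.mulVec (gram (fun i j => a i j x t₀) (m + 1)) (fun k => z k x t) =
      fun l : Fin (m + 1) => a l 0 x t := by
    change Matrix.mulVec _ (Matrix.mulVec (gram (fun i j => a i j x t₀) (m + 1))⁻¹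
      fun l : Fin (m + 1) => a l 0 x t) = _
    rw [Matrix.mulVec_mulVec, Matrix.mul_nonsing_inv _ (isUnit_iff_ne_zero.mpr (hd x hx t₀ ht₀)),
      Matrix.one_mulVec]
  have h1 := congrFun h0 0
  simp only [Fin.val_zero] at h1
  rw [← h1]
  simp only [kernelDeriv, iteratedDeriv_zero]
  simp only [hz x hx t ht]
  rfl

/-! ### The tower of a smooth function -/

section SmoothTower

variable {Ω : Set (𝕜 × 𝕜)} {f g : 𝕜 → 𝕜 → 𝕜} {x t : 𝕜}

lemma hasDerivAt_fst_of_differentiableAt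
    (hf : DifferentiableAt 𝕜 (fun p : 𝕜 × 𝕜 => f p.1 p.2) (x, t)) :
    HasDerivAt (fun y => f y t) (fderiv 𝕜 (fun p : 𝕜 × 𝕜 => f p.1 p.2) (x, t) (1, 0)) x := by
  have h : HasDerivAt (fun y : 𝕜 => (y, t)) (1, 0) x :=
    (hasDerivAt_id x).prodMk (hasDerivAt_const x t)
  exact HasFDerivAt.comp_hasDerivAt (f := fun y : 𝕜 => (y, t)) x hf.hasFDerivAt h

lemma hasDerivAt_snd_of_differentiableAt
    (hf : DifferentiableAt 𝕜 (fun p : 𝕜 × 𝕜 => f p.1 p.2) (x, t)) :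
    HasDerivAt (fun s => f x s) (fderiv 𝕜 (fun p : 𝕜 × 𝕜 => f p.1 p.2) (x, t) (0, 1)) t := by
  have h : HasDerivAt (fun s : 𝕜 => (x, s)) (0, 1) t :=
    (hasDerivAt_const t x).prodMk (hasDerivAt_id t)
  exact HasFDerivAt.comp_hasDerivAt (f := fun s : 𝕜 => (x, s)) t hf.hasFDerivAt h

lemma differentiableAt_of_contDiffOn (hΩ : IsOpen Ω)
    (hf : ContDiffOn 𝕜 ∞ (fun p : 𝕜 × 𝕜 => f p.1 p.2) Ω) {p : 𝕜 × 𝕜} (hp : p ∈ Ω) :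
    DifferentiableAt 𝕜 (fun p : 𝕜 × 𝕜 => f p.1 p.2) p :=
  (hf.differentiableOn (by simp)).differentiableAt (hΩ.mem_nhds hp)

lemma dx_eq_fderiv (hΩ : IsOpen Ω) (hf : ContDiffOn 𝕜 ∞ (fun p : 𝕜 × 𝕜 => f p.1 p.2) Ω)
    {p : 𝕜 × 𝕜} (hp : p ∈ Ω) :
    dx f p.1 p.2 = fderiv 𝕜 (fun p : 𝕜 × 𝕜 => f p.1 p.2) p (1, 0) :=
  (hasDerivAt_fst_of_differentiableAt (differentiableAt_of_contDiffOn hΩ hf hp)).deriv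

lemma dt_eq_fderiv (hΩ : IsOpen Ω) (hf : ContDiffOn 𝕜 ∞ (fun p : 𝕜 × 𝕜 => f p.1 p.2) Ω)
    {p : 𝕜 × 𝕜} (hp : p ∈ Ω) :
    dt f p.1 p.2 = fderiv 𝕜 (fun p : 𝕜 × 𝕜 => f p.1 p.2) p (0, 1) :=
  (hasDerivAt_snd_of_differentiableAt (differentiableAt_of_contDiffOn hΩ hf hp)).deriv

lemma contDiffOn_fderiv_apply (hΩ : IsOpen Ω) {F : 𝕜 × 𝕜 → 𝕜} (hF : ContDiffOn 𝕜 ∞ F Ω)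
    (v : 𝕜 × 𝕜) : ContDiffOn 𝕜 ∞ (fun p => fderiv 𝕜 F p v) Ω :=
  (hF.fderiv_of_isOpen hΩ (by simp)).clm_apply contDiffOn_const

lemma contDiffOn_dx (hΩ : IsOpen Ω) (hf : ContDiffOn 𝕜 ∞ (fun p : 𝕜 × 𝕜 => f p.1 p.2) Ω) :
    ContDiffOn 𝕜 ∞ (fun p : 𝕜 × 𝕜 => dx f p.1 p.2) Ω :=
  (contDiffOn_fderiv_apply hΩ hf (1, 0)).congr fun _ hp => dx_eq_fderiv hΩ hf hp

lemma contDiffOn_dt (hΩ : IsOpen Ω) (hf : ContDiffOn 𝕜 ∞ (fun p : 𝕜 × 𝕜 => f p.1 p.2) Ω) :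
    ContDiffOn 𝕜 ∞ (fun p : 𝕜 × 𝕜 => dt f p.1 p.2) Ω :=
  (contDiffOn_fderiv_apply hΩ hf (0, 1)).congr fun _ hp => dt_eq_fderiv hΩ hf hp

lemma dt_dx_comm (hΩ : IsOpen Ω) (hf : ContDiffOn 𝕜 ∞ (fun p : 𝕜 × 𝕜 => f p.1 p.2) Ω)
    {p : 𝕜 × 𝕜} (hp : p ∈ Ω) : dt (dx f) p.1 p.2 = dx (dt f) p.1 p.2 := by
  rw [dt_eq_fderiv hΩ (contDiffOn_dx hΩ hf) hp, dx_eq_fderiv hΩ (contDiffOn_dt hΩ hf) hp]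
  have h1 : (fun p : 𝕜 × 𝕜 => dx f p.1 p.2) =ᶠ[nhds p]
      fun p => fderiv 𝕜 (fun p : 𝕜 × 𝕜 => f p.1 p.2) p (1, 0) := by
    filter_upwards [hΩ.mem_nhds hp] with q hq using dx_eq_fderiv hΩ hf hq
  have h2 : (fun p : 𝕜 × 𝕜 => dt f p.1 p.2) =ᶠ[nhds p]
      fun p => fderiv 𝕜 (fun p : 𝕜 × 𝕜 => f p.1 p.2) p (0, 1) := by
    filter_upwards [hΩ.mem_nhds hp] with q hq using dt_eq_fderiv hΩ hf hq
  have hd : DifferentiableAt 𝕜 (fderiv 𝕜 fun p : 𝕜 × 𝕜 => f p.1 p.2) p :=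
    ((hf.fderiv_of_isOpen (m := ∞) hΩ (by simp)).differentiableOn
      (by simp)).differentiableAt (hΩ.mem_nhds hp)
  rw [h1.fderiv_eq, h2.fderiv_eq, fderiv_clm_apply hd (differentiableAt_const _),
    fderiv_clm_apply hd (differentiableAt_const _)]
  have hsymm := (hf.contDiffAt (hΩ.mem_nhds hp)).isSymmSndFDerivAt (by
    rw [minSmoothness_of_isRCLikeNormedField]
    exact WithTop.coe_le_coe.2 le_top)
  simpa using hsymm.eq (0, 1) (1, 0)

lemma dx_congr (hΩ : IsOpen Ω) (h : ∀ p ∈ Ω, f p.1 p.2 = g p.1 p.2) {p : 𝕜 × 𝕜} (hp : p ∈ Ω) :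
    dx f p.1 p.2 = dx g p.1 p.2 := by
  refine Filter.EventuallyEq.deriv_eq ?_
  have hc : Continuous fun y : 𝕜 => (y, p.2) := by fun_prop
  filter_upwards [(hΩ.preimage hc).mem_nhds (show p.1 ∈ _ from hp)] with y hy using h _ hy

/-- In the tower the `x`-derivatives are taken last, so a further `t`-derivative has to be moved
inside them by symmetry of second derivatives. -/
lemma dt_iterate_dx (hΩ : IsOpen Ω) (hf : ContDiffOn 𝕜 ∞ (fun p : 𝕜 × 𝕜 => f p.1 p.2) Ω)
    (i : ℕ) : ContDiffOn 𝕜 ∞ (fun p : 𝕜 × 𝕜 => dx^[i] f p.1 p.2) Ω ∧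
      ∀ p ∈ Ω, dt (dx^[i] f) p.1 p.2 = dx^[i] (dt f) p.1 p.2 := by
  induction i with
  | zero => exact ⟨hf, fun p _ => rfl⟩
  | succ i ih =>
    simp only [Function.iterate_succ_apply']
    refine ⟨contDiffOn_dx hΩ ih.1, fun p hp => ?_⟩
    rw [dt_dx_comm hΩ ih.1 hp, dx_congr hΩ ih.2 hp]

/-- The partial derivatives of a smooth function form a tower. -/
lemma tower_iterate {I J : Set 𝕜} (hI : IsOpen I) (hJ : IsOpen J)
    (hf : ContDiffOn 𝕜 ∞ (fun p : 𝕜 × 𝕜 => f p.1 p.2) (I ×ˢ J)) :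
    Tower I J fun i j => dx^[i] (dt^[j] f) := by
  have hΩ : IsOpen (I ×ˢ J) := hI.prod hJ
  have h1 : ∀ j, ContDiffOn 𝕜 ∞ (fun p : 𝕜 × 𝕜 => dt^[j] f p.1 p.2) (I ×ˢ J) := by
    intro j
    induction j with
    | zero => exact hf
    | succ j ih =>
      simp only [Function.iterate_succ_apply']
      exact contDiffOn_dt hΩ ih
  constructor
  · intro i j x hx t ht
    simp only [Function.iterate_succ_apply']
    exact (hasDerivAt_fst_of_differentiableAt (differentiableAt_of_contDiffOn hΩ
      (dt_iterate_dx hΩ (h1 j) i).1 ⟨hx, ht⟩)).differentiableAt.hasDerivAt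
  · intro i j x hx t ht
    have h2 := (dt_iterate_dx hΩ (h1 j) i).2 (x, t) ⟨hx, ht⟩
    simp only [Function.iterate_succ_apply' dt]
    rw [← h2]
    exact (hasDerivAt_snd_of_differentiableAt (differentiableAt_of_contDiffOn hΩ
      (dt_iterate_dx hΩ (h1 j) i).1 ⟨hx, ht⟩)).differentiableAt.hasDerivAt

end SmoothTower

/-! ### Quotients of determinants and the finite boundary value -/

section Quotients

variable {K : Type*} [Field K]

/-- The quotients `v_n = det (a_ij) / det (b_kl)`, with `v_0 = 0`. -/
noncomputable def quotient (e : ℕ → ℕ → K) : ℕ → K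
  | 0 => 0
  | m + 1 => (gram e (m + 1))⁻¹ 0 0

lemma quotient_succ_eq_div (e : ℕ → ℕ → K) (m : ℕ) :
    quotient e (m + 1) = coreMinor e m / (gram e (m + 1)).det := inv_gram_zero e m

lemma quotient_succ_sub {e : ℕ → ℕ → K} {m : ℕ} (h : (gram e m).det ≠ 0)
    (h' : (gram e (m + 1)).det ≠ 0) :
    (gram e (m + 1))⁻¹ (Fin.last _) (Fin.last _) ≠ 0 ∧
    quotient e (m + 1) - quotient e m =
      (gram e (m + 1))⁻¹ 0 (Fin.last _) * (gram e (m + 1))⁻¹ (Fin.last _) 0 /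
        (gram e (m + 1))⁻¹ (Fin.last _) (Fin.last _) := by
  cases m with
  | zero =>
    have h0 : e 0 0 ≠ 0 := by simpa using h'
    simp only [quotient]
    rw [inv_gram_one, inv_gram_one, inv_gram_one, inv_gram_one]
    refine ⟨inv_ne_zero h0, ?_⟩
    field_simp
    ring
  | succ m => exact inv_gram_sub_of_succ h h'

/-- Adding 1/(a - b) to 1/(φ - a) gives 0 exactly at φ = b, so b is moved to ∞. Up to a nonzero
factor the changed determinant is PQ - S(b - φ), with φ the last finite value, P and Q the entries
at 0 of `colCoef` and `rowCoef`, and S the Schur complement; its vanishing is the lattice relation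
at the last site. -/
lemma det_gram_bump_eq_zero_iff {e : ℕ → ℕ → K} {m : ℕ} {a b : K} (hab : a ≠ b)
    (h : (gram e (m + 1)).det ≠ 0) (hb : quotient e (m + 1) + a ≠ b) :
    (gram (bump 0 (1 / (a - b)) e) (m + 2)).det = 0 ↔
      1 / (b - (quotient e (m + 1) + a)) * (colCoef e m 0 * rowCoef e m 0) = schur e m := by
  have h1 : a - b ≠ 0 := sub_ne_zero.2 hab
  have h2 : b - (quotient e (m + 1) + a) ≠ 0 := sub_ne_zero.2 hb.symm
  rw [det_gram_bump_zero, coreMinor_succ h, det_gram_succ h]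
  change _ + 1 / (a - b) * (_ * (quotient e (m + 1) * schur e m + _)) = 0 ↔ _
  have h3 : (gram e (m + 1)).det * schur e m + 1 / (a - b) * ((gram e (m + 1)).det *
      (quotient e (m + 1) * schur e m + colCoef e m 0 * rowCoef e m 0)) =
      (gram e (m + 1)).det / (a - b) * (colCoef e m 0 * rowCoef e m 0 -
        schur e m * (b - (quotient e (m + 1) + a))) := by
    field_simp
    ring
  rw [h3, mul_eq_zero, or_iff_right (div_ne_zero h h1), sub_eq_zero, one_div_mul_eq_div,
    div_eq_iff h2]

end Quotients

section Site

variable {K : Type*}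

lemma site_of_lt {N : ℕ} {a : K} {b : OnePoint K} {v : ℕ → K → K → K} {n : ℕ} {x t : K}
    (hn : 1 ≤ n) (hnN : n < N) : site N a b v n x t = (v n x t : OnePoint K) := by
  rw [site, if_neg (by omega), if_pos hnN]

lemma site_zero (N : ℕ) (a : K) (b : OnePoint K) (v : ℕ → K → K → K) (x t : K) :
    site N a b v 0 x t = (a : OnePoint K) := if_pos rfl

lemma site_self {N : ℕ} (hN : 1 ≤ N) (a : K) (b : OnePoint K) (v : ℕ → K → K → K) (x t : K) :
    site N a b v N x t = b := by
  rw [site, if_neg (by omega), if_neg (lt_irrefl N)]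

end Site

/-! ### The lattice equation as a recursion -/

lemma recipDiff_coe (p q : 𝕜) : recipDiff (p : OnePoint 𝕜) (q : OnePoint 𝕜) = 1 / (p - q) := rfl

lemma recipDiff_infty (q : OnePoint 𝕜) : recipDiff OnePoint.infty q = 0 := by
  cases q <;> rfl

/-- In terms of the Schur complement the lattice equation at a site is an algebraic relation that
determines the next site. -/
lemma Tower.equation_iff {I J : Set 𝕜} {A : ℕ → ℕ → 𝕜 → 𝕜 → 𝕜} (hI : IsOpen I) (hJ : IsOpen J)
    (hA : Tower I J A) {N : ℕ} {a : 𝕜} {b : OnePoint 𝕜} {φ : ℕ → 𝕜 → 𝕜 → 𝕜} {m : ℕ} (hm : m + 1 < N)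
    (hd : ∀ x ∈ I, ∀ t ∈ J, (gram (fun i j => A i j x t) m).det ≠ 0)
    (hd' : ∀ x ∈ I, ∀ t ∈ J, (gram (fun i j => A i j x t) (m + 1)).det ≠ 0)
    (hφ : ∀ x ∈ I, ∀ t ∈ J,
      site N a b φ m x t = (quotient (fun i j => A i j x t) m + a : 𝕜))
    (hφ' : ∀ x ∈ I, ∀ t ∈ J,
      site N a b φ (m + 1) x t = (quotient (fun i j => A i j x t) (m + 1) + a : 𝕜))
    (hne : NeighboursDistinct N a b I J φ) {x t : 𝕜} (hx : x ∈ I) (ht : t ∈ J) :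
    let e : ℕ → ℕ → 𝕜 := fun i j => A i j x t
    (dt (φ (m + 1)) x t ≠ 0 ↔ colCoef e m 0 ≠ 0) ∧ (dx (φ (m + 1)) x t ≠ 0 ↔ rowCoef e m 0 ≠ 0) ∧
    (dx (dt (φ (m + 1))) x t = dt (φ (m + 1)) x t * dx (φ (m + 1)) x t *
      (recipDiff (site N a b φ (m + 1) x t) (site N a b φ m x t)
        - recipDiff (site N a b φ (m + 1 + 1) x t) (site N a b φ (m + 1) x t)) ↔
      recipDiff (site N a b φ (m + 2) x t) (site N a b φ (m + 1) x t) *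
        (colCoef e m 0 * rowCoef e m 0) = schur e m) := by
  intro e
  have hval : ∀ x ∈ I, ∀ t ∈ J, φ (m + 1) x t = (gram (fun i j => A i j x t) (m + 1))⁻¹ 0 0 + a := by
    intro x hx t ht
    have := hφ' x hx t ht
    rw [site_of_lt (by omega) hm] at this
    exact OnePoint.coe_injective this
  obtain ⟨h1, h2, h3⟩ := hA.deriv_formulas hI hJ hd' hval hx ht
  obtain ⟨hγ, hdiff⟩ := quotient_succ_sub (hd x hx t ht) (hd' x hx t ht)
  have hn := hne m (by omega) x hx t ht
  rw [hφ x hx t ht, hφ' x hx t ht] at hn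
  have hn' : quotient e (m + 1) - quotient e m ≠ 0 := fun h0 => hn (by rw [sub_eq_zero.1 h0])
  rw [hdiff] at hn'
  rw [h1, h2, h3]
  change _ ∧ _ ∧ (_ ↔ recipDiff (site N a b φ (m + 1 + 1) x t) _ * _ = _)
  generalize hρ : recipDiff (site N a b φ (m + 1 + 1) x t) (site N a b φ (m + 1) x t) = ρ
  rw [hφ x hx t ht, hφ' x hx t ht, recipDiff_coe, add_sub_add_right_eq_sub, hdiff]
  change (gram e (m + 1))⁻¹ 0 (Fin.last m) * (gram e (m + 1))⁻¹ (Fin.last m) 0 /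
    (gram e (m + 1))⁻¹ (Fin.last m) (Fin.last m) ≠ 0 at hn'
  -- Sites `m` and `m + 1` differ by αβ/γ, with α, β, γ the entries named below, so their
  -- distinctness gives α, β ≠ 0.
  have hα : (gram e (m + 1))⁻¹ 0 (Fin.last m) ≠ 0 := fun h0 => hn' (by rw [h0]; simp)
  have hβ : (gram e (m + 1))⁻¹ (Fin.last m) 0 ≠ 0 := fun h0 => hn' (by rw [h0]; simp)
  change (gram e (m + 1))⁻¹ (Fin.last m) (Fin.last m) ≠ 0 at hγ
  refine ⟨?_, ?_, ?_⟩
  · rw [neg_ne_zero, mul_ne_zero_iff]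
    exact and_iff_right hβ
  · rw [neg_ne_zero, mul_ne_zero_iff]
    exact and_iff_right hα
  · change (gram e (m + 1))⁻¹ (Fin.last m) (Fin.last m) * (colCoef e m 0 * rowCoef e m 0) -
      (gram e (m + 1))⁻¹ 0 (Fin.last m) * (gram e (m + 1))⁻¹ (Fin.last m) 0 * schur e m =
      -((gram e (m + 1))⁻¹ (Fin.last m) 0 * colCoef e m 0) *
      -((gram e (m + 1))⁻¹ 0 (Fin.last m) * rowCoef e m 0) *
      (1 / ((gram e (m + 1))⁻¹ 0 (Fin.last m) * (gram e (m + 1))⁻¹ (Fin.last m) 0 /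
        (gram e (m + 1))⁻¹ (Fin.last m) (Fin.last m)) - ρ) ↔ _
    generalize (gram e (m + 1))⁻¹ (Fin.last m) (Fin.last m) = γ at *
    generalize (gram e (m + 1))⁻¹ 0 (Fin.last m) = α at *
    generalize (gram e (m + 1))⁻¹ (Fin.last m) 0 = β at *
    -- The backward term γ/(αβ) of the equation cancels the γ-term of the mixed derivative; what
    -- remains is αβ times the forward relation.
    have key : γ * (colCoef e m 0 * rowCoef e m 0) - α * β * schur e m -
        -(β * colCoef e m 0) * -(α * rowCoef e m 0) * (1 / (α * β / γ) - ρ) =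
        α * β * (ρ * (colCoef e m 0 * rowCoef e m 0) - schur e m) := by
      field_simp
      ring
    rw [← sub_eq_zero, key, mul_eq_zero, or_iff_right (mul_ne_zero hα hβ), sub_eq_zero]

/-- The quotients of determinants solve the lattice, as soon as the relation at the last site
holds. -/
lemma Tower.isSolution {I J : Set 𝕜} {A : ℕ → ℕ → 𝕜 → 𝕜 → 𝕜} (hI : IsOpen I) (hJ : IsOpen J)
    (hA : Tower I J A) {M : ℕ} {a : 𝕜} {b : OnePoint 𝕜} {φ : ℕ → 𝕜 → 𝕜 → 𝕜}
    (hsm : ∀ n, 1 ≤ n → n < M + 2 → ContDiffOn 𝕜 ∞ (fun p : 𝕜 × 𝕜 => φ n p.1 p.2) (I ×ˢ J))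
    (hd : ∀ n < M + 2, ∀ x ∈ I, ∀ t ∈ J, (gram (fun i j => A i j x t) n).det ≠ 0)
    (hφ : ∀ n, n + 1 < M + 2 → ∀ x ∈ I, ∀ t ∈ J,
      φ (n + 1) x t = quotient (fun i j => A i j x t) (n + 1) + a)
    (hne : NeighboursDistinct (M + 2) a b I J φ)
    (hlast : ∀ x ∈ I, ∀ t ∈ J,
      recipDiff b ((quotient (fun i j => A i j x t) (M + 1) + a : 𝕜) : OnePoint 𝕜) *
        (colCoef (fun i j => A i j x t) M 0 * rowCoef (fun i j => A i j x t) M 0) =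
          schur (fun i j => A i j x t) M) :
    IsSolution (M + 2) a b I J φ ∧ Nondegenerate (M + 2) I J φ := by
  have hsite : ∀ n < M + 2, ∀ x ∈ I, ∀ t ∈ J,
      site (M + 2) a b φ n x t = (quotient (fun i j => A i j x t) n + a : 𝕜) := by
    intro n hn x hx t ht
    cases n with
    | zero => rw [site_zero, quotient, zero_add]
    | succ n => rw [site_of_lt (by omega) hn, hφ n hn x hx t ht]
  -- At interior sites the corner formula is the required relation. Distinctness of the next two
  -- sites makes the product of coefficients nonzero, which is nondegeneracy.
  have hstep : ∀ m, m + 2 < M + 2 → ∀ x ∈ I, ∀ t ∈ J,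
      schur (fun i j => A i j x t) m ≠ 0 ∧
      quotient (fun i j => A i j x t) (m + 2) - quotient (fun i j => A i j x t) (m + 1) =
        colCoef (fun i j => A i j x t) m 0 * rowCoef (fun i j => A i j x t) m 0 /
          schur (fun i j => A i j x t) m ∧
      colCoef (fun i j => A i j x t) m 0 * rowCoef (fun i j => A i j x t) m 0 ≠ 0 := by
    intro m hm x hx t ht
    have h1 := hd (m + 1) (by omega) x hx t ht
    have hs : schur (fun i j => A i j x t) m ≠ 0 := fun h0 =>
      hd (m + 2) hm x hx t ht (by rw [det_gram_succ h1, h0, mul_zero])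
    have hdiff : quotient (fun i j => A i j x t) (m + 2) -
        quotient (fun i j => A i j x t) (m + 1) =
        colCoef (fun i j => A i j x t) m 0 * rowCoef (fun i j => A i j x t) m 0 /
          schur (fun i j => A i j x t) m := by
      simp only [quotient]
      rw [inv_gram_succ_corner h1 hs, add_sub_cancel_left]
    refine ⟨hs, hdiff, fun h0 => ?_⟩
    rw [h0, zero_div, sub_eq_zero] at hdiff
    refine hne (m + 1) (by omega) x hx t ht ?_
    rw [hsite _ (by omega) x hx t ht, hsite _ (by omega) x hx t ht, ← hdiff]
  refine ⟨⟨hsm, hne, ?_⟩, ?_⟩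
  · intro n hn hnM x hx t ht
    obtain ⟨m, rfl⟩ : ∃ m, n = m + 1 := ⟨n - 1, by omega⟩
    refine (hA.equation_iff hI hJ hnM (hd m (by omega)) (hd (m + 1) hnM) (hsite m (by omega))
      (hsite (m + 1) hnM) hne hx ht).2.2.2 ?_
    rw [hsite (m + 1) hnM x hx t ht]
    by_cases hm : m + 2 < M + 2
    · obtain ⟨hs, hdiff, hPQ⟩ := hstep m hm x hx t ht
      rw [hsite _ hm x hx t ht, recipDiff_coe, add_sub_add_right_eq_sub, hdiff,
        one_div_div, div_mul_cancel₀ _ hPQ]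
    · obtain rfl : m = M := by omega
      rw [site_self (by omega)]
      exact hlast x hx t ht
  · intro n hn hnM x hx t ht
    obtain ⟨m, rfl⟩ : ∃ m, n = m + 1 := ⟨n - 1, by omega⟩
    obtain ⟨h1, h2, -⟩ := hA.equation_iff hI hJ (by omega) (hd m (by omega)) (hd (m + 1) (by omega))
      (hsite m (by omega)) (hsite (m + 1) (by omega)) hne hx ht
    obtain ⟨-, -, hPQ⟩ := hstep m (by omega) x hx t ht
    exact ⟨h1.2 (left_ne_zero_of_mul hPQ), h2.2 (right_ne_zero_of_mul hPQ)⟩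

/-- A nondegenerate solution consists of the quotients of determinants built from the derivatives of
`1 / (v_1 - v_0)`. -/
lemma IsSolution.exists_tower {I J : Set 𝕜} (hI : IsOpen I) (hJ : IsOpen J) {M : ℕ} {a : 𝕜}
    {b : OnePoint 𝕜} {φ : ℕ → 𝕜 → 𝕜 → 𝕜} (hφ : IsSolution (M + 2) a b I J φ)
    (hnd : Nondegenerate (M + 2) I J φ) :
    ∃ A : ℕ → ℕ → 𝕜 → 𝕜 → 𝕜, Tower I J A ∧
      (∀ n < M + 2, ∀ x ∈ I, ∀ t ∈ J, (gram (fun i j => A i j x t) n).det ≠ 0 ∧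
        site (M + 2) a b φ n x t = (quotient (fun i j => A i j x t) n + a : 𝕜)) ∧
      ∀ x ∈ I, ∀ t ∈ J,
        recipDiff b ((quotient (fun i j => A i j x t) (M + 1) + a : 𝕜) : OnePoint 𝕜) *
          (colCoef (fun i j => A i j x t) M 0 * rowCoef (fun i j => A i j x t) M 0) =
            schur (fun i j => A i j x t) M := by
  have hne : ∀ x ∈ I, ∀ t ∈ J, φ 1 x t - a ≠ 0 := by
    intro x hx t ht h0
    refine hφ.distinct 0 (by omega) x hx t ht ?_
    rw [site_zero, site_of_lt (by omega) (by omega), sub_eq_zero.1 h0]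
  -- The kernel is forced: the first quotient is the reciprocal of the entry at (0, 0).
  have hsm : ContDiffOn 𝕜 ∞ (fun p : 𝕜 × 𝕜 => (φ 1 p.1 p.2 - a)⁻¹) (I ×ˢ J) :=
    ((hφ.smooth 1 le_rfl (by omega)).sub contDiffOn_const).inv fun p hp => hne _ hp.1 _ hp.2
  have hA := tower_iterate (f := fun x t => (φ 1 x t - a)⁻¹) hI hJ hsm
  set A : ℕ → ℕ → 𝕜 → 𝕜 → 𝕜 := fun i j => dx^[i] (dt^[j] fun x t => (φ 1 x t - a)⁻¹) with hAdef
  have hA0 : ∀ x t, A 0 0 x t = (φ 1 x t - a)⁻¹ := fun x t => rfl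
  clear_value A
  have good : ∀ m, m + 1 < M + 2 → ∀ n ≤ m + 1, ∀ x ∈ I, ∀ t ∈ J,
      (gram (fun i j => A i j x t) n).det ≠ 0 ∧
        site (M + 2) a b φ n x t = (quotient (fun i j => A i j x t) n + a : 𝕜) := by
    intro m
    induction m with
    | zero =>
      intro _ n hn x hx t ht
      rcases Nat.le_one_iff_eq_zero_or_eq_one.1 hn with rfl | rfl
      · refine ⟨by simp, ?_⟩
        rw [site_zero, quotient, zero_add]
      · refine ⟨by simpa [hA0] using hne x hx t ht, ?_⟩
        rw [site_of_lt le_rfl (by omega), quotient, inv_gram_one, hA0, inv_inv, sub_add_cancel]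
    | succ m ih =>
      intro hm n hn
      rcases Nat.le_succ_iff.1 hn with hn | rfl
      · exact ih (by omega) n hn
      intro x hx t ht
      have ih := ih (by omega)
      obtain ⟨h1, h2, h3⟩ := hA.equation_iff hI hJ (m := m) (by omega)
        (fun x hx t ht => (ih m (by omega) x hx t ht).1)
        (fun x hx t ht => (ih (m + 1) le_rfl x hx t ht).1)
        (fun x hx t ht => (ih m (by omega) x hx t ht).2)
        (fun x hx t ht => (ih (m + 1) le_rfl x hx t ht).2) hφ.distinct hx ht
      have h4 := h3.1 (hφ.equation (m + 1) (by omega) (by omega) x hx t ht)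
      have hn := hnd (m + 1) (by omega) (by omega) x hx t ht
      have hP := h1.1 hn.1
      have hQ := h2.1 hn.2
      obtain ⟨hd, hs⟩ := ih (m + 1) le_rfl x hx t ht
      rw [hs, site_of_lt (by omega) (by omega), recipDiff_coe] at h4
      have hdist := hφ.distinct (m + 1) (by omega) x hx t ht
      rw [hs, site_of_lt (by omega) (by omega)] at hdist
      have hsub : φ (m + 2) x t - (quotient (fun i j => A i j x t) (m + 1) + a) ≠ 0 :=
        fun h0 => hdist (by rw [← sub_eq_zero.1 h0])
      -- Nondegeneracy at site `m + 1` makes the Schur complement nonzero, so the next block is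
      -- invertible and the relation can be solved for site `m + 2`.
      have hschur : schur (fun i j => A i j x t) m ≠ 0 := by
        rw [← h4]
        exact mul_ne_zero (one_div_ne_zero hsub) (mul_ne_zero hP hQ)
      refine ⟨det_gram_succ_ne_zero hd hschur, ?_⟩
      rw [site_of_lt (by omega) (by omega)]
      congr 1
      have h5 : quotient (fun i j => A i j x t) (m + 2) = quotient (fun i j => A i j x t) (m + 1) +
          colCoef (fun i j => A i j x t) m 0 * rowCoef (fun i j => A i j x t) m 0 /
            schur (fun i j => A i j x t) m := inv_gram_succ_corner hd hschur
      have h6 : colCoef (fun i j => A i j x t) m 0 * rowCoef (fun i j => A i j x t) m 0 /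
            schur (fun i j => A i j x t) m =
          φ (m + 2) x t - (quotient (fun i j => A i j x t) (m + 1) + a) := by
        rw [div_eq_iff hschur, ← h4, ← mul_assoc, mul_one_div_cancel hsub, one_mul]
      rw [h5, h6]
      ring
  refine ⟨A, hA, fun n hn => good M (by omega) n (by omega), fun x hx t ht => ?_⟩
  have good := good M (by omega)
  -- At the last site the relation is kept unsolved; no nondegeneracy is needed there.
  have h3 := (hA.equation_iff hI hJ (m := M) (by omega)
    (fun x hx t ht => (good M (by omega) x hx t ht).1)
    (fun x hx t ht => (good (M + 1) le_rfl x hx t ht).1)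
    (fun x hx t ht => (good M (by omega) x hx t ht).2)
    (fun x hx t ht => (good (M + 1) le_rfl x hx t ht).2) hφ.distinct hx ht).2.2.1
    (hφ.equation (M + 1) (by omega) (by omega) x hx t ht)
  rwa [site_self (by omega), (good (M + 1) le_rfl x hx t ht).2] at h3

/-! ### From the determinant formulas to quotients, and the four implications -/

lemma vSol_succ {m : ℕ} (X T : Fin m → 𝕜 → 𝕜) (n : ℕ) (x t : 𝕜) :
    vSol X T (n + 1) x t = quotient (fun i j => kernelDeriv X T i j x t) (n + 1) := by
  rw [quotient_succ_eq_div]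
  rfl

lemma phiDen_succ {m : ℕ} {a b : 𝕜} (hab : a ≠ b) (X T : Fin m → 𝕜 → 𝕜) (n : ℕ) (x t : 𝕜) :
    phiDen a b X T (n + 1) x t = (a - b) *
      (gram (bump 0 (-(1 / (a - b))) fun i j => kernelDeriv X T i j x t) (n + 1)).det := by
  have h1 : a - b ≠ 0 := sub_ne_zero.2 hab
  rw [phiDen, detB_eq, detA_succ_eq, det_gram_bump_zero]
  field_simp
  ring

/-- In terms of reciprocals the Möbius map is the translation 1/(φ - a) = 1/v - 1/(a - b). On
determinants it changes only the entry at (0, 0), which the numerator does not contain. -/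
lemma phiSol_succ {m : ℕ} {a b : 𝕜} (hab : a ≠ b) (X T : Fin m → 𝕜 → 𝕜) (n : ℕ) (x t : 𝕜) :
    phiSol a b X T (n + 1) x t =
      quotient (bump 0 (-(1 / (a - b))) fun i j => kernelDeriv X T i j x t) (n + 1) + a := by
  rw [phiSol, phiDen_succ hab, quotient_succ_eq_div, coreMinor_bump_zero, detA_succ_eq,
    mul_div_mul_left _ _ (sub_ne_zero.2 hab)]

lemma bump_bump_neg {K : Type*} [Field K] (k : ℕ) (c : K) (e : ℕ → ℕ → K) :
    bump k c (bump k (-c) e) = e := by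
  ext i j
  by_cases h : i = k ∧ j = k <;> simp [bump, h]

lemma bump_neg_bump {K : Type*} [Field K] (k : ℕ) (c : K) (e : ℕ → ℕ → K) :
    bump k (-c) (bump k c e) = e := by
  simpa using bump_bump_neg k (-c) e

section

variable {I J : Set 𝕜} {M : ℕ}

lemma vSol_isSolution (hI : IsOpen I) (hJ : IsOpen J) {X T : Fin (M + 1) → 𝕜 → 𝕜}
    (hX : ∀ s, ContDiffOn 𝕜 ∞ (X s) I) (hT : ∀ s, ContDiffOn 𝕜 ∞ (T s) J)
    (hB : ∀ n, 1 ≤ n → n < M + 2 → ∀ x ∈ I, ∀ t ∈ J, detB X T n x t ≠ 0)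
    (hne : NeighboursDistinct (M + 2) 0 OnePoint.infty I J (vSol X T)) :
    IsSolution (M + 2) 0 OnePoint.infty I J (vSol X T) ∧ Nondegenerate (M + 2) I J (vSol X T) ∧
      ∀ x ∈ I, ∀ t ∈ J, detB X T (M + 2) x t = 0 ∧
        (dt (vSol X T (M + 1)) x t ≠ 0 → dx (vSol X T (M + 1)) x t ≠ 0 →
          detA X T (M + 2) x t ≠ 0) := by
  have hA := tower_kernelDeriv hI hJ hX hT
  have hd : ∀ n < M + 2, ∀ x ∈ I, ∀ t ∈ J,
      (gram (fun i j => kernelDeriv X T i j x t) n).det ≠ 0 := by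
    intro n hn x hx t ht
    rcases Nat.eq_zero_or_pos n with rfl | h
    · simp
    · exact hB n h hn x hx t ht
  have hB0 : ∀ x t, detB X T (M + 2) x t = 0 := detB_succ_eq_zero X T
  have hschur : ∀ x ∈ I, ∀ t ∈ J, schur (fun i j => kernelDeriv X T i j x t) M = 0 := by
    intro x hx t ht
    have h1 := hd (M + 1) (by omega) x hx t ht
    have h0 := hB0 x t
    rw [detB_eq, det_gram_succ h1] at h0
    exact (mul_eq_zero.1 h0).resolve_left h1
  obtain ⟨h1, h2⟩ := hA.isSolution hI hJ (φ := vSol X T) (M := M) (a := 0) (b := OnePoint.infty)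
    (fun n hn hnM => (contDiffOn_detA hI hJ hX hT n).div (contDiffOn_detB hI hJ hX hT n)
      fun p hp => hB n hn hnM _ hp.1 _ hp.2) hd
    (fun n _ x _ t _ => by rw [vSol_succ, add_zero]) hne
    (fun x hx t ht => by rw [recipDiff_infty, zero_mul, hschur x hx t ht])
  refine ⟨h1, h2, fun x hx t ht => ⟨hB0 x t, fun h3 h4 => ?_⟩⟩
  obtain ⟨h5, h6, -⟩ := hA.deriv_formulas hI hJ (f := vSol X T (M + 1)) (r := 0)
    (hd (M + 1) (by omega)) (fun x _ t _ => by rw [vSol_succ, add_zero]; rfl) hx ht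
  rw [h6] at h3
  rw [h5] at h4
  -- With Schur complement zero the numerator is the determinant times two coefficients, each a
  -- factor of one of the first derivatives.
  rw [detA_succ_eq, coreMinor_succ (hd (M + 1) (by omega) x hx t ht), hschur x hx t ht, mul_zero,
    zero_add]
  exact mul_ne_zero (hd (M + 1) (by omega) x hx t ht)
    (mul_ne_zero (right_ne_zero_of_mul (neg_ne_zero.1 h3))
      (right_ne_zero_of_mul (neg_ne_zero.1 h4)))

lemma exists_vSol_of_isSolution (hI : IsOpen I) (hI' : IsPreconnected I) (hJ : IsOpen J)
    (hJ' : IsPreconnected J) {v : ℕ → 𝕜 → 𝕜 → 𝕜}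
    (hv : IsSolution (M + 2) 0 OnePoint.infty I J v) (hnd : Nondegenerate (M + 2) I J v) :
    ∃ X T : Fin (M + 1) → 𝕜 → 𝕜,
      (∀ s, ContDiffOn 𝕜 ∞ (X s) I) ∧ (∀ s, ContDiffOn 𝕜 ∞ (T s) J) ∧
      ∀ n, 1 ≤ n → n < M + 2 → ∀ x ∈ I, ∀ t ∈ J,
        detB X T n x t ≠ 0 ∧ v n x t = detA X T n x t / detB X T n x t := by
  obtain ⟨A, hA, hgood, hlast⟩ := hv.exists_tower hI hJ hnd
  obtain ⟨X, T, hX, hT, hXT⟩ := hA.exists_kernel hI hI' hJ hJ' (m := M)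
    (fun x hx t ht => (hgood (M + 1) (by omega) x hx t ht).1) (fun x hx t ht => by
      have h := hlast x hx t ht
      rw [recipDiff_infty, zero_mul] at h
      rw [det_gram_succ (hgood (M + 1) (by omega) x hx t ht).1, ← h, mul_zero])
  refine ⟨X, T, hX, hT, fun n hn hnM x hx t ht => ?_⟩
  obtain ⟨m, rfl⟩ : ∃ m, n = m + 1 := ⟨n - 1, by omega⟩
  obtain ⟨h1, h2⟩ := hgood (m + 1) hnM x hx t ht
  have he : (fun i j => A i j x t) = fun i j => kernelDeriv X T i j x t :=
    funext fun i => funext fun j => hXT i j x hx t ht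
  rw [he] at h1 h2
  rw [site_of_lt (by omega) hnM, add_zero, quotient_succ_eq_div] at h2
  exact ⟨h1, OnePoint.coe_injective h2⟩

lemma phiSol_isSolution (hI : IsOpen I) (hJ : IsOpen J) {a b : 𝕜} (hab : a ≠ b)
    {X T : Fin (M + 1) → 𝕜 → 𝕜}
    (hX : ∀ s, ContDiffOn 𝕜 ∞ (X s) I) (hT : ∀ s, ContDiffOn 𝕜 ∞ (T s) J)
    (hB : ∀ n, 1 ≤ n → n < M + 2 → ∀ x ∈ I, ∀ t ∈ J, phiDen a b X T n x t ≠ 0)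
    (hne : NeighboursDistinct (M + 2) a (b : OnePoint 𝕜) I J (phiSol a b X T)) :
    IsSolution (M + 2) a (b : OnePoint 𝕜) I J (phiSol a b X T) ∧
      Nondegenerate (M + 2) I J (phiSol a b X T) := by
  have hA := (tower_kernelDeriv hI hJ hX hT).bump (-(1 / (a - b)))
  have hd : ∀ n < M + 2, ∀ x ∈ I, ∀ t ∈ J,
      (gram (bump 0 (-(1 / (a - b))) fun i j => kernelDeriv X T i j x t) n).det ≠ 0 := by
    intro n hn x hx t ht
    cases n with
    | zero => simp
    | succ n =>
      have := hB (n + 1) (by omega) hn x hx t ht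
      rw [phiDen_succ hab] at this
      exact right_ne_zero_of_mul this
  refine hA.isSolution hI hJ (φ := phiSol a b X T) (M := M) (fun n hn hnM => ?_) hd
    (fun n _ x _ t _ => phiSol_succ hab X T n x t) hne (fun x hx t ht => ?_)
  · refine ((contDiffOn_const.mul (contDiffOn_detA hI hJ hX hT n)).div
      ((contDiffOn_const.mul (contDiffOn_detB hI hJ hX hT n)).sub (contDiffOn_detA hI hJ hX hT n))
      fun p hp => hB n hn hnM _ hp.1 _ hp.2).add contDiffOn_const
  · have hb := hne (M + 1) (by omega) x hx t ht
    rw [site_of_lt (by omega) (by omega), site_self (by omega), phiSol_succ hab] at hb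
    refine (det_gram_bump_eq_zero_iff hab (hd (M + 1) (by omega) x hx t ht)
      fun h0 => hb (congrArg _ h0)).1 ?_
    -- Undoing the translation returns the kernel itself, a sum of only `M + 1` products.
    rw [bump_bump_neg]
    exact detB_succ_eq_zero X T x t

lemma exists_phiSol_of_isSolution (hI : IsOpen I) (hI' : IsPreconnected I) (hJ : IsOpen J)
    (hJ' : IsPreconnected J) {a b : 𝕜} (hab : a ≠ b) {φ : ℕ → 𝕜 → 𝕜 → 𝕜}
    (hφ : IsSolution (M + 2) a (b : OnePoint 𝕜) I J φ) (hnd : Nondegenerate (M + 2) I J φ) :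
    ∃ X T : Fin (M + 1) → 𝕜 → 𝕜,
      (∀ s, ContDiffOn 𝕜 ∞ (X s) I) ∧ (∀ s, ContDiffOn 𝕜 ∞ (T s) J) ∧
      ∀ n, 1 ≤ n → n < M + 2 → ∀ x ∈ I, ∀ t ∈ J,
        phiDen a b X T n x t ≠ 0 ∧ φ n x t = phiSol a b X T n x t := by
  have hab' : a - b ≠ 0 := sub_ne_zero.2 hab
  obtain ⟨A, hA, hgood, hlast⟩ := hφ.exists_tower hI hJ hnd
  have hb : ∀ x ∈ I, ∀ t ∈ J, quotient (fun i j => A i j x t) (M + 1) + a ≠ b := by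
    intro x hx t ht h0
    refine hφ.distinct (M + 1) (by omega) x hx t ht ?_
    rw [(hgood (M + 1) (by omega) x hx t ht).2, site_self (by omega), h0]
  -- The translated tower is the one to factor. Its block of size `M + 1` has the old determinant
  -- times 1 + q/(a - b), where q is the last quotient; this vanishes only if q + a = b.
  obtain ⟨X, T, hX, hT, hXT⟩ := (hA.bump (1 / (a - b))).exists_kernel hI hI' hJ hJ' (m := M)
    (fun x hx t ht => by
      have h1 := (hgood (M + 1) (by omega) x hx t ht).1
      have h2 := hb x hx t ht
      change (gram (bump 0 (1 / (a - b)) fun i j => A i j x t) (M + 1)).det ≠ 0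
      rw [det_gram_bump_zero]
      rw [quotient_succ_eq_div] at h2
      intro h0
      apply h2
      field_simp at h0 ⊢
      linear_combination h0)
    (fun x hx t ht => (det_gram_bump_eq_zero_iff hab (hgood (M + 1) (by omega) x hx t ht).1
      (hb x hx t ht)).2 (hlast x hx t ht))
  refine ⟨X, T, hX, hT, fun n hn hnM x hx t ht => ?_⟩
  obtain ⟨m, rfl⟩ : ∃ m, n = m + 1 := ⟨n - 1, by omega⟩
  obtain ⟨h1, h2⟩ := hgood (m + 1) hnM x hx t ht
  have he : (bump 0 (-(1 / (a - b))) fun i j => kernelDeriv X T i j x t) =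
      fun i j => A i j x t := by
    rw [← bump_neg_bump 0 (1 / (a - b)) fun i j => A i j x t]
    congr 1
    exact funext fun i => funext fun j => (hXT i j x hx t ht).symm
  rw [site_of_lt (by omega) hnM] at h2
  rw [phiDen_succ hab, phiSol_succ hab, he]
  exact ⟨mul_ne_zero hab' h1, OnePoint.coe_injective h2⟩

end

lemma phiSol_eq_mobius {m : ℕ} (a b : 𝕜) (X T : Fin m → 𝕜 → 𝕜) (n : ℕ) (x t : 𝕜)
    (h : detB X T n x t ≠ 0) : phiSol a b X T n x t = mobius a b (vSol X T n x t) := by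
  have h1 : phiDen a b X T n x t =
      (a - b - detA X T n x t / detB X T n x t) * detB X T n x t := by
    rw [phiDen]
    field_simp
  rw [phiSol, mobius, vSol, h1, ← mul_div_assoc, div_div, mul_comm (detB X T n x t)]

end FSY

theorem mainTheorem5 {𝕜 : Type*} [RCLike 𝕜] (N : ℕ) (hN : 2 ≤ N) (I J : Set 𝕜)
    (hI : IsOpen I) (hI' : IsPreconnected I) (hJ : IsOpen J) (hJ' : IsPreconnected J) :
    -- boundary condition `v_0 = 0`, `v_N = ∞`: the formula gives solutions
    (∀ X T : Fin (N - 1) → 𝕜 → 𝕜,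
      (∀ s, ContDiffOn 𝕜 ∞ (X s) I) → (∀ s, ContDiffOn 𝕜 ∞ (T s) J) →
      (∀ n, 1 ≤ n → n < N → ∀ x ∈ I, ∀ t ∈ J, FSY.detB X T n x t ≠ 0) →
      FSY.NeighboursDistinct N 0 OnePoint.infty I J (FSY.vSol X T) →
        FSY.IsSolution N 0 OnePoint.infty I J (FSY.vSol X T) ∧
        FSY.Nondegenerate N I J (FSY.vSol X T) ∧
        -- the formula with `n = N` has denominator zero, and is a genuine `∞` (nonzero numerator)
        -- wherever the derivatives of `v_{N-1}` do not vanish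
        ∀ x ∈ I, ∀ t ∈ J, FSY.detB X T N x t = 0 ∧
          (FSY.dt (FSY.vSol X T (N - 1)) x t ≠ 0 → FSY.dx (FSY.vSol X T (N - 1)) x t ≠ 0 →
            FSY.detA X T N x t ≠ 0)) ∧
    -- boundary condition `v_0 = 0`, `v_N = ∞`: every nondegenerate solution is given by the formula
    (∀ v : ℕ → 𝕜 → 𝕜 → 𝕜,
      FSY.IsSolution N 0 OnePoint.infty I J v → FSY.Nondegenerate N I J v →
        ∃ X T : Fin (N - 1) → 𝕜 → 𝕜,
          (∀ s, ContDiffOn 𝕜 ∞ (X s) I) ∧ (∀ s, ContDiffOn 𝕜 ∞ (T s) J) ∧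
          ∀ n, 1 ≤ n → n < N → ∀ x ∈ I, ∀ t ∈ J,
            FSY.detB X T n x t ≠ 0 ∧ v n x t = FSY.detA X T n x t / FSY.detB X T n x t) ∧
    -- boundary condition `φ_0 = a`, `φ_N = b`
    (∀ a b : 𝕜, a ≠ b →
      (∀ X T : Fin (N - 1) → 𝕜 → 𝕜,
        (∀ s, ContDiffOn 𝕜 ∞ (X s) I) → (∀ s, ContDiffOn 𝕜 ∞ (T s) J) →
        (∀ n, 1 ≤ n → n < N → ∀ x ∈ I, ∀ t ∈ J, FSY.phiDen a b X T n x t ≠ 0) →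
        FSY.NeighboursDistinct N a (b : OnePoint 𝕜) I J (FSY.phiSol a b X T) →
          FSY.IsSolution N a (b : OnePoint 𝕜) I J (FSY.phiSol a b X T) ∧
          FSY.Nondegenerate N I J (FSY.phiSol a b X T)) ∧
      (∀ φ : ℕ → 𝕜 → 𝕜 → 𝕜,
        FSY.IsSolution N a (b : OnePoint 𝕜) I J φ → FSY.Nondegenerate N I J φ →
          ∃ X T : Fin (N - 1) → 𝕜 → 𝕜,
            (∀ s, ContDiffOn 𝕜 ∞ (X s) I) ∧ (∀ s, ContDiffOn 𝕜 ∞ (T s) J) ∧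
            ∀ n, 1 ≤ n → n < N → ∀ x ∈ I, ∀ t ∈ J,
              FSY.phiDen a b X T n x t ≠ 0 ∧ φ n x t = FSY.phiSol a b X T n x t) ∧
      -- `phiSol` is the Möbius image of `vSol`
      (∀ (X T : Fin (N - 1) → 𝕜 → 𝕜) (n : ℕ) (x t : 𝕜), FSY.detB X T n x t ≠ 0 →
        FSY.phiSol a b X T n x t = FSY.mobius a b (FSY.vSol X T n x t))) := by
  obtain ⟨M, rfl⟩ : ∃ M, N = M + 2 := ⟨N - 2, by omega⟩
  refine ⟨fun X T hX hT hB hne => FSY.vSol_isSolution hI hJ hX hT hB hne,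
    fun v hv hnd => FSY.exists_vSol_of_isSolution hI hI' hJ hJ' hv hnd, fun a b hab => ⟨?_, ?_, ?_⟩⟩
  · exact fun X T hX hT hB hne => FSY.phiSol_isSolution hI hJ hab hX hT hB hne
  · exact fun φ hφ hnd => FSY.exists_phiSol_of_isSolution hI hI' hJ hJ' hab hφ hnd
  · exact fun X T n x t h => FSY.phiSol_eq_mobius a b X T n x t h
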